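/- **Theorem (Convergence of active learning).** Let $X$ (inputs) and $Y$ (class labels) be finite sets and let $\Theta$ be a measurable space with measurable singletons and a reference measure $\lambda$ (the counting measure when $\Theta$ is discrete). Let $\Pr(y\mid\theta,x)$ be a classification model: a probability distribution on $Y$ for each $(\theta,x)\in\Theta\times X$, measurable in $\theta$. Let $p$ be a prior density with respect to $\lambda$, and let $\theta_r\in\Theta$ have positive prior probability. The model is fully conditional: for labelled data $L$ (a finite list of pairs $(x,y)$) the posterior is $$\Pr(\theta\mid L)=\frac{p(\theta)\prod_{(x,y)\in L}\Pr(y\mid\theta,x)}{\int p(t)\prod_{(x,y)\in L}\Pr(y\mid t,x)\,d\lambda(t)},$$ and $\Pr(y\mid L,x)=\int\Pr(y\mid\theta,x)\Pr(\theta\mid L)\,d\lambda(\theta)$. For a cost $Q$ of labelled data put $$\Delta Q(x\mid L)=Q(L)-\sum_{y}\Pr(y\mid L,x)\,Q(L\cup\{(x,y)\}).$$ Active learning with acquisition function $\Delta Q$ starts from $L_0=\emptyset$. At step $n$ it queries an input $x_n\in\arg\max_{x\in X}\Delta Q(x\mid L_n)$ (inputs may be queried repeatedly, and ties are broken arbitrarily,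 possibly at random, without looking into the future), receives a label $y_n$ which, given the past, is distributed as $\Pr(\cdot\mid\theta_r,x_n)$, and sets $L_{n+1}=L_n\cup\{(x_n,y_n)\}$. 1. (BALD) Let $Q_I(L)=-\int\Pr(\theta\mid L)\log\Pr(\theta\mid L)\,d\lambda(\theta)$ be the entropy of the posterior (Shannon's entropy when $\Theta$ is discrete), where $p\log p$ is $\lambda$-integrable. Suppose that the model is identifiable: if $\Pr(\cdot\mid\theta,x)=\Pr(\cdot\mid\theta',x)$ for all $x\in X$, then $\theta=\theta'$. If the data are acquired with $\Delta Q_I$, then almost surely $\Delta Q_I(x\mid L_n)\to0$ for every $x\in X$, and $\Pr(\cdot\mid L_n)$ converges on every measurable set to the point mass at $\theta_r$. 2. (BEMPS) Let $\Pr(x)$ be a probability distribution on $X$ and let $S(q,y)$ be a strictly proper scoring rule for distributions $q$ on $Y$: $S(q,y)$ is a real number, except that it may be $-\infty$ when $q(y)=0$, and $\sum_y q'(y)S(q,y)<\sum_y q'(y)S(q',y)$ for all distributions $q\ne q'$ (with $0\cdot(-\infty)=0$). Suppose that $G(q)=\sum_y q(y)S(q,y)$ is continuous on the probability simplex. Let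 $$Q_S(L)=\sum_{x\in X}\Pr(x)\int\sum_{y}\Pr(y\mid\theta,x)\bigl(S(\Pr(\cdot\mid\theta,x),y)-S(\Pr(\cdot\mid L,x),y)\bigr)\Pr(\theta\mid L)\,d\lambda(\theta).$$ Suppose that the model is identifiable from the inputs with $\Pr(x)>0$: if $\Pr(\cdot\mid\theta,x)=\Pr(\cdot\mid\theta',x)$ for all $x$ with $\Pr(x)>0$, then $\theta=\theta'$. If the data are acquired with $\Delta Q_S$, then almost surely $\Delta Q_S(x\mid L_n)\to0$ for every $x\in X$, $Q_S(L_n)\to0$, and $\Pr(\cdot\mid L_n)$ converges on every measurable set to the point mass at $\theta_r$. -/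

import Mathlib

open MeasureTheory Filter Topology

noncomputable section

namespace ActiveLearning

/-- A conditional classification model `Pr(y | θ, x)` with parameters `θ : Θ`, inputs `x : X`
and class labels `y : Y`. -/
structure Model (Θ X Y : Type*) [MeasurableSpace Θ] [Fintype Y] where
  prob : Θ → X → Y → ℝ
  prob_nonneg : ∀ θ x y, 0 ≤ prob θ x y
  prob_sum : ∀ θ x, ∑ y, prob θ x y = 1
  measurable_prob : ∀ x y, Measurable fun θ => prob θ x y

/-- A prior density `p` with respect to a reference measure `base` on the parameter space.
For a discrete parameter space `base` is the counting measure, and then `p θ` is the prior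
probability of `θ`. -/
structure IsPriorDensity {Θ : Type*} [MeasurableSpace Θ] (base : Measure Θ) (p : Θ → ℝ) :
    Prop where
  nonneg : ∀ θ, 0 ≤ p θ
  integrable : Integrable p base
  integral_eq_one : ∫ θ, p θ ∂base = 1

/-- The score functional of a scoring rule for forecast `q` under label distribution `p`:
`E_{y ∼ p} S(q, y)`, with `0 * (-∞) = 0`. -/
def expectedScore {Y : Type*} [Fintype Y] (S : (Y → ℝ) → Y → EReal) (p q : Y → ℝ) : EReal :=
  ∑ y, (p y : EReal) * S q y

/-- A (regular) strictly proper scoring rule for categorical variables. The score is a real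
number, except that it may be `-∞` (as for the logarithmic rule) at labels to which the forecast
assigns probability `0`. -/
structure IsStrictlyProper {Y : Type*} [Fintype Y] (S : (Y → ℝ) → Y → EReal) : Prop where
  ne_top : ∀ q ∈ stdSimplex ℝ Y, ∀ y, S q y ≠ ⊤
  ne_bot : ∀ q ∈ stdSimplex ℝ Y, ∀ y, q y ≠ 0 → S q y ≠ ⊥
  strict : ∀ p ∈ stdSimplex ℝ Y, ∀ q ∈ stdSimplex ℝ Y, q ≠ p →
    expectedScore S p q < expectedScore S p p

/-- The generalized negative entropy `G(q) = ∑ y, q(y) S(q, y)` of a scoring rule. For a regular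
scoring rule a value `-∞` of `S q y` only occurs together with the weight `q y = 0`. -/
def savageG {Y : Type*} [Fintype Y] (S : (Y → ℝ) → Y → EReal) (q : Y → ℝ) : ℝ :=
  ∑ y, q y * (S q y).toReal

namespace Model

variable {Θ X Y : Type*} [MeasurableSpace Θ] [Fintype X] [Fintype Y]

/-- The parameter is determined by the label distributions at the inputs in `s`. -/
def IdentifiableOn (M : Model Θ X Y) (s : Set X) : Prop :=
  ∀ θ θ', (∀ x ∈ s, ∀ y, M.prob θ x y = M.prob θ' x y) → θ = θ'

/-- The (conditional) likelihood `∏ Pr(y | θ, x)` of labelled data, a list of input-label pairs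
in which repetitions count. -/
def likelihood (M : Model Θ X Y) (L : List (X × Y)) (θ : Θ) : ℝ :=
  (L.map fun z => M.prob θ z.1 z.2).prod

/-- The posterior `Pr(θ | L)`, as a density with respect to `base`. The model is fully conditional:
the posterior depends on the inputs only through the conditional label probabilities. -/
def posterior (M : Model Θ X Y) (base : Measure Θ) (p : Θ → ℝ) (L : List (X × Y)) (θ : Θ) : ℝ :=
  p θ * M.likelihood L θ / ∫ t, p t * M.likelihood L t ∂base

/-- The posterior predictive `Pr(y | L, x)`. -/
def predictive (M : Model Θ X Y) (base : Measure Θ) (p : Θ → ℝ) (L : List (X × Y)) (x : X)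
    (y : Y) : ℝ :=
  ∫ θ, M.prob θ x y * M.posterior base p L θ ∂base

/-- The acquisition function of a cost `Q`:
`ΔQ(x | L) = Q(L) - E_{Pr(y | L, x)} Q(L ∪ {(x, y)})`. -/
def deltaQ (M : Model Θ X Y) (base : Measure Θ) (p : Θ → ℝ) (Q : List (X × Y) → ℝ)
    (L : List (X × Y)) (x : X) : ℝ :=
  Q L - ∑ y, M.predictive base p L x y * Q ((x, y) :: L)

/-- The BALD cost: the entropy of the posterior (Shannon's entropy if `base` is the counting
measure). -/
def costI (M : Model Θ X Y) (base : Measure Θ) (p : Θ → ℝ) (L : List (X × Y)) : ℝ :=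
  ∫ θ, Real.negMulLog (M.posterior base p L θ) ∂base

/-- The BEMPS cost: the expected difference, under the input distribution `px` and the posterior,
between the score of the model with parameter `θ` and the score of the posterior predictive.
For a regular scoring rule the value `-∞` is only met with weight `0`. -/
def costS (M : Model Θ X Y) (base : Measure Θ) (p : Θ → ℝ) (px : X → ℝ)
    (S : (Y → ℝ) → Y → EReal) (L : List (X × Y)) : ℝ :=
  ∑ x, px x * ∫ θ, (∑ y, M.prob θ x y *
    ((S (M.prob θ x) y).toReal - (S (M.predictive base p L x) y).toReal)) *
      M.posterior base p L θ ∂base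

end Model

/-- The labelled data `L_n` after `n` steps in which the inputs `x 0, …, x (n - 1)` were queried and
the labels `y 0, …, y (n - 1)` received. -/
def labelled {X Y : Type*} (x : ℕ → X) (y : ℕ → Y) : ℕ → List (X × Y)
  | 0 => []
  | n + 1 => (x n, y n) :: labelled x y n

/-- A run of active learning with acquisition function `acq`, on data generated by the parameter
`θr`: at each step an input that maximizes the acquisition function given the data so far is
queried (ties are broken in any, possibly random, way that does not look into the future), and given
the past and the queried input the label is drawn from `Pr(· | θr, x)`. -/
structure IsRun {Θ X Y Ω : Type*} [MeasurableSpace Θ] [Fintype Y] {m : MeasurableSpace Ω}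
    (M : Model Θ X Y) (θr : Θ) (acq : List (X × Y) → X → ℝ) (μ : Measure Ω)
    (ℱ : Filtration ℕ m) (x : ℕ → Ω → X) (y : ℕ → Ω → Y) : Prop where
  input_adapted : ∀ n a, MeasurableSet[ℱ n] {ω | x n ω = a}
  label_adapted : ∀ n b, MeasurableSet[ℱ (n + 1)] {ω | y n ω = b}
  label_law : ∀ n b, μ[Set.indicator {ω | y n ω = b} (fun _ => (1 : ℝ)) | ℱ n]
    =ᵐ[μ] fun ω => M.prob θr (x n ω) b
  maximizes : ∀ᵐ ω ∂μ, ∀ n a,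
    acq (labelled (x · ω) (y · ω) n) a ≤ acq (labelled (x · ω) (y · ω) n) (x n ω)

/-- The distributions with densities `f n` with respect to `base` converge to the point mass
at `θr`, on every measurable set. -/
def TendstoPointMass {Θ : Type*} [MeasurableSpace Θ] (base : Measure Θ) (f : ℕ → Θ → ℝ)
    (θr : Θ) : Prop :=
  ∀ A, MeasurableSet A →
    Tendsto (fun n => ∫ θ in A, f n θ ∂base) atTop (𝓝 (A.indicator (fun _ => (1 : ℝ)) θr))

end ActiveLearning

end

/-!
The proof works with the posterior as a measure `post L` and rests on a change of measure. Let
`evidenceRatio` be the evidence of the data divided by their likelihood under `θr`: the density, on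
data possible under `θr`, of the Bayesian law of the data, in which the parameter is drawn from the
prior, with respect to the true law. There it is bounded below by the prior mass of `θr`.

The acquisition function `ΔQ` is the expected decrease of `Q` under the Bayesian law. Hence under
the true law, for a nonnegative cost `Q`, the weighted cost `evidenceRatio * Q` has drift at most
`-evidenceRatio * ΔQ` (`Model.sum_prob_mul_evidenceRatio_mul_le`). If also `0 ≤ ΔQ`, adding the
accumulated `evidenceRatio * ΔQ` gives a nonnegative supermartingale, which converges. So almost
surely the weighted cost converges and `ΔQ` tends to `0` at the queried inputs (`IsRun.ae_tendsto`).
Posterior means of bounded nonnegative functions are costs with `ΔQ = 0`, and so converge as well.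

*BEMPS.* The cost is nonnegative and `ΔQ_S` is a weighted sum of the differences in Jensen's
inequality for the convex function `savageG S`. So `ΔQ_S` is nonnegative and tends to `0` at the
queried inputs and, since these are maximizers, at all inputs. Let `a` be an input of positive
probability. In the limit, observing the label at `a` gives no gain for predicting the label at `a`
itself. Strict convexity then forces the posterior variance of each `Pr(y | θ, a)` to vanish
(`tendsto_postVar_of_predictiveGain`).

*BALD.* The entropy of the posterior need not be bounded below, so it cannot serve as the cost `Q`
above. The posterior variances of the label probabilities can: their acquisition function at `x`
dominates the square of the variance at `x` itself (`Model.sq_postVar_le_deltaQ`), so the variances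
at the queried inputs tend to `0`. By uniform continuity of the entropy the mutual information
`ΔQ_I` tends to `0` at the queried inputs, hence everywhere, and it dominates the variances at all
inputs (`Model.sum_postVar_le_jensenGap`).

*Concentration.* As the posterior mass of `θr` stays away from `0`, vanishing variances make the
posterior mean of the squared distance of the label probabilities from those of `θr` tend to `0`.
By identifiability this distance vanishes only at `θr`. Parameters close to `θr` in this distance
are dealt with by Fatou's lemma: their weighted posterior mass has mean at most their prior mass,
which is arbitrarily small (`IsRun.ae_tendsto_post_compl`).
-/

noncomputable section

namespace ActiveLearning

namespace Model

variable {Θ X Y : Type*} [MeasurableSpace Θ] [Fintype Y]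
  (M : Model Θ X Y) {base : Measure Θ} {p : Θ → ℝ}

/-! ### The posterior as a measure -/

lemma prob_le_one (θ : Θ) (x : X) (y : Y) : M.prob θ x y ≤ 1 := by
  rw [← M.prob_sum θ x]
  exact Finset.single_le_sum (fun b _ => M.prob_nonneg θ x b) (Finset.mem_univ y)

lemma prob_mem_stdSimplex (θ : Θ) (x : X) : M.prob θ x ∈ stdSimplex ℝ Y :=
  ⟨M.prob_nonneg θ x, M.prob_sum θ x⟩

@[simp] lemma likelihood_nil (θ : Θ) : M.likelihood [] θ = 1 := by simp [likelihood]

@[simp] lemma likelihood_cons (x : X) (y : Y) (L : List (X × Y)) (θ : Θ) :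
    M.likelihood ((x, y) :: L) θ = M.prob θ x y * M.likelihood L θ := by simp [likelihood]

lemma likelihood_nonneg (L : List (X × Y)) (θ : Θ) : 0 ≤ M.likelihood L θ := by
  induction L with
  | nil => simp
  | cons z L ih => obtain ⟨x, y⟩ := z; simpa using mul_nonneg (M.prob_nonneg θ x y) ih

lemma likelihood_le_one (L : List (X × Y)) (θ : Θ) : M.likelihood L θ ≤ 1 := by
  induction L with
  | nil => simp
  | cons z L ih =>
    obtain ⟨x, y⟩ := z
    simpa using mul_le_one₀ (M.prob_le_one θ x y) (M.likelihood_nonneg L θ) ih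

lemma measurable_likelihood (L : List (X × Y)) : Measurable (M.likelihood L) := by
  induction L with
  | nil =>
    have : M.likelihood [] = fun _ => 1 := funext fun θ => M.likelihood_nil θ
    rw [this]; exact measurable_const
  | cons z L ih =>
    obtain ⟨x, y⟩ := z
    have : M.likelihood ((x, y) :: L) = fun θ => M.prob θ x y * M.likelihood L θ :=
      funext fun θ => M.likelihood_cons x y L θ
    rw [this]; exact (M.measurable_prob x y).mul ih

variable (base p) in
/-- The evidence (marginal likelihood) of the data `L`: the normalizing constant of the
posterior. -/
def evidence (L : List (X × Y)) : ℝ := ∫ t, p t * M.likelihood L t ∂base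

lemma posterior_eq (L : List (X × Y)) (θ : Θ) :
    M.posterior base p L θ = p θ * M.likelihood L θ / M.evidence base p L := rfl

lemma integrable_prior_mul_likelihood (hp : IsPriorDensity base p) (L : List (X × Y)) :
    Integrable (fun θ => p θ * M.likelihood L θ) base := by
  refine hp.integrable.mono
    (hp.integrable.aestronglyMeasurable.mul (M.measurable_likelihood L).aestronglyMeasurable)
    (ae_of_all _ fun θ => ?_)
  rw [norm_mul, Real.norm_of_nonneg (M.likelihood_nonneg L θ)]
  exact mul_le_of_le_one_right (norm_nonneg _) (M.likelihood_le_one L θ)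

lemma evidence_nonneg (hp : IsPriorDensity base p) (L : List (X × Y)) :
    0 ≤ M.evidence base p L :=
  integral_nonneg fun θ => mul_nonneg (hp.nonneg θ) (M.likelihood_nonneg L θ)

lemma evidence_nil (hp : IsPriorDensity base p) : M.evidence base p [] = 1 := by
  simp [evidence, hp.integral_eq_one]

lemma posterior_nonneg (hp : IsPriorDensity base p) (L : List (X × Y)) (θ : Θ) :
    0 ≤ M.posterior base p L θ :=
  div_nonneg (mul_nonneg (hp.nonneg θ) (M.likelihood_nonneg L θ)) (M.evidence_nonneg hp L)

lemma integrable_posterior (hp : IsPriorDensity base p) (L : List (X × Y)) :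
    Integrable (M.posterior base p L) base :=
  (M.integrable_prior_mul_likelihood hp L).div_const _

variable (base p) in
/-- The posterior as a measure on the parameter space. It is a probability measure, unless the
data `L` has evidence `0`; in that case it is the zero measure. -/
def post (L : List (X × Y)) : Measure Θ :=
  base.withDensity fun θ => ENNReal.ofReal (M.posterior base p L θ)

lemma integral_post (hp : IsPriorDensity base p) (L : List (X × Y)) (g : Θ → ℝ) :
    ∫ θ, g θ ∂M.post base p L = ∫ θ, g θ * M.posterior base p L θ ∂base := by
  rw [post, integral_withDensity_eq_integral_toReal_smul₀
    (M.integrable_posterior hp L).aemeasurable.ennreal_ofReal (by simp)]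
  refine integral_congr_ae (ae_of_all _ fun θ => ?_)
  simp [ENNReal.toReal_ofReal (M.posterior_nonneg hp L θ), mul_comm]

lemma post_apply (hp : IsPriorDensity base p) (L : List (X × Y)) {A : Set Θ}
    (hA : MeasurableSet A) :
    M.post base p L A = ENNReal.ofReal (∫ θ in A, M.posterior base p L θ ∂base) := by
  rw [post, withDensity_apply _ hA, ofReal_integral_eq_lintegral_ofReal
    (M.integrable_posterior hp L).integrableOn (ae_of_all _ (M.posterior_nonneg hp L))]

lemma post_real_apply (hp : IsPriorDensity base p) (L : List (X × Y)) {A : Set Θ}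
    (hA : MeasurableSet A) :
    (M.post base p L).real A = ∫ θ in A, M.posterior base p L θ ∂base := by
  rw [measureReal_def, M.post_apply hp L hA,
    ENNReal.toReal_ofReal (integral_nonneg (M.posterior_nonneg hp L))]

lemma integral_posterior (L : List (X × Y)) :
    ∫ θ, M.posterior base p L θ ∂base = M.evidence base p L / M.evidence base p L := by
  simp_rw [posterior_eq]
  rw [integral_div]; rfl

lemma isProbabilityMeasure_post (hp : IsPriorDensity base p) {L : List (X × Y)}
    (hL : M.evidence base p L ≠ 0) : IsProbabilityMeasure (M.post base p L) := by
  refine ⟨?_⟩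
  rw [M.post_apply hp L MeasurableSet.univ, setIntegral_univ, integral_posterior, div_self hL]
  simp

lemma post_eq_zero {L : List (X × Y)} (hL : M.evidence base p L = 0) :
    M.post base p L = 0 := by
  have : (fun θ => ENNReal.ofReal (M.posterior base p L θ)) = 0 := by
    funext θ; simp [posterior_eq, hL]
  rw [post, this, withDensity_zero]

lemma isZeroOrProbabilityMeasure_post (hp : IsPriorDensity base p) (L : List (X × Y)) :
    IsZeroOrProbabilityMeasure (M.post base p L) := by
  by_cases hL : M.evidence base p L = 0
  · rw [M.post_eq_zero hL]; infer_instance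
  · have := M.isProbabilityMeasure_post hp hL; infer_instance

lemma isFiniteMeasure_post (hp : IsPriorDensity base p) (L : List (X × Y)) :
    IsFiniteMeasure (M.post base p L) := by
  have := M.isZeroOrProbabilityMeasure_post hp L
  infer_instance

lemma predictive_eq (hp : IsPriorDensity base p) (L : List (X × Y)) (x : X) (y : Y) :
    M.predictive base p L x y = ∫ θ, M.prob θ x y ∂M.post base p L := by
  rw [M.integral_post hp]; rfl

lemma predictive_nonneg (hp : IsPriorDensity base p) (L : List (X × Y)) (x : X) (y : Y) :
    0 ≤ M.predictive base p L x y :=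
  integral_nonneg fun θ => mul_nonneg (M.prob_nonneg θ x y) (M.posterior_nonneg hp L θ)

lemma evidence_cons (hp : IsPriorDensity base p) (L : List (X × Y)) (x : X) (y : Y) :
    M.evidence base p ((x, y) :: L) = M.evidence base p L * M.predictive base p L x y := by
  by_cases h : M.evidence base p L = 0
  · rw [h, zero_mul]
    have h0 : (fun t => p t * M.likelihood L t) =ᵐ[base] 0 :=
      (integral_eq_zero_iff_of_nonneg
        (fun θ => mul_nonneg (hp.nonneg θ) (M.likelihood_nonneg L θ))
        (M.integrable_prior_mul_likelihood hp L)).1 h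
    refine integral_eq_zero_of_ae ?_
    filter_upwards [h0] with t ht
    have ht' : p t * M.likelihood L t = 0 := ht
    simp only [likelihood_cons, Pi.zero_apply]
    rw [mul_left_comm, ht', mul_zero]
  · rw [predictive, ← integral_const_mul]
    refine integral_congr_ae (ae_of_all _ fun θ => ?_)
    simp only [likelihood_cons, posterior_eq]
    field_simp

lemma integrable_post_of_bound (hp : IsPriorDensity base p) (L : List (X × Y)) {g : Θ → ℝ}
    (hg : Measurable g) (C : ℝ) (hC : ∀ θ, |g θ| ≤ C) : Integrable g (M.post base p L) := by
  have := M.isFiniteMeasure_post hp L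
  exact Integrable.of_bound hg.aestronglyMeasurable C (ae_of_all _ hC)

lemma integrable_prob (hp : IsPriorDensity base p) (L : List (X × Y)) (x : X) (y : Y) :
    Integrable (fun θ => M.prob θ x y) (M.post base p L) :=
  M.integrable_post_of_bound hp L (M.measurable_prob x y) 1 fun θ => by
    rw [abs_of_nonneg (M.prob_nonneg θ x y)]; exact M.prob_le_one θ x y

/-- A label of predictive probability `0` has probability `0` under almost every parameter. -/
lemma prob_ae_eq_zero (hp : IsPriorDensity base p) {L : List (X × Y)} {x : X} {y : Y}
    (h : M.predictive base p L x y = 0) : ∀ᵐ θ ∂M.post base p L, M.prob θ x y = 0 := by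
  rw [M.predictive_eq hp] at h
  exact (integral_eq_zero_iff_of_nonneg (fun θ => M.prob_nonneg θ x y)
    (M.integrable_prob hp L x y)).1 h

lemma prob_mul_posterior_ae_eq_zero (hp : IsPriorDensity base p) {L : List (X × Y)} {x : X} {y : Y}
    (h : M.predictive base p L x y = 0) :
    ∀ᵐ θ ∂base, M.prob θ x y * M.posterior base p L θ = 0 := by
  refine (integral_eq_zero_iff_of_nonneg
    (fun θ => mul_nonneg (M.prob_nonneg θ x y) (M.posterior_nonneg hp L θ)) ?_).1 h
  refine (M.integrable_posterior hp L).mono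
    ((M.measurable_prob x y).aestronglyMeasurable.mul
      (M.integrable_posterior hp L).aestronglyMeasurable) (ae_of_all _ fun θ => ?_)
  rw [norm_mul, Real.norm_of_nonneg (M.prob_nonneg θ x y)]
  exact mul_le_of_le_one_left (norm_nonneg _) (M.prob_le_one θ x y)

/-- Bayes' rule for one further label. -/
lemma predictive_mul_posterior_cons (hp : IsPriorDensity base p) (L : List (X × Y)) (x : X)
    (y : Y) (h : M.predictive base p L x y ≠ 0) (θ : Θ) :
    M.predictive base p L x y * M.posterior base p ((x, y) :: L) θ =
      M.prob θ x y * M.posterior base p L θ := by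
  by_cases hL : M.evidence base p L = 0
  · exact absurd (by rw [M.predictive_eq hp, M.post_eq_zero hL, integral_zero_measure]) h
  · rw [posterior_eq, posterior_eq, likelihood_cons, M.evidence_cons hp L x y]
    field_simp

lemma predictive_mul_integral_post_cons (hp : IsPriorDensity base p) (L : List (X × Y)) (x : X)
    (y : Y) (g : Θ → ℝ) :
    M.predictive base p L x y * ∫ θ, g θ ∂M.post base p ((x, y) :: L) =
      ∫ θ, M.prob θ x y * g θ ∂M.post base p L := by
  by_cases h : M.predictive base p L x y = 0
  · rw [h, zero_mul]
    refine (integral_eq_zero_of_ae ?_).symm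
    filter_upwards [M.prob_ae_eq_zero hp h] with θ hθ
    simp [hθ]
  · rw [M.integral_post hp, M.integral_post hp, ← integral_const_mul]
    refine integral_congr_ae (ae_of_all _ fun θ => ?_)
    simp only
    rw [mul_left_comm, M.predictive_mul_posterior_cons hp L x y h]
    ring

lemma predictive_mem_stdSimplex (hp : IsPriorDensity base p) {L : List (X × Y)}
    (hL : M.evidence base p L ≠ 0) (x : X) : M.predictive base p L x ∈ stdSimplex ℝ Y := by
  have := M.isProbabilityMeasure_post hp hL
  refine ⟨M.predictive_nonneg hp L x, ?_⟩
  simp_rw [M.predictive_eq hp]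
  rw [← integral_finsetSum _ fun y _ => M.integrable_prob hp L x y]
  simp [M.prob_sum]

lemma predictive_eq_zero {L : List (X × Y)} (hp : IsPriorDensity base p)
    (hL : M.evidence base p L = 0) (x : X) (y : Y) : M.predictive base p L x y = 0 := by
  rw [M.predictive_eq hp, M.post_eq_zero hL, integral_zero_measure]

/-- The posterior expectation of a function of the parameter is a martingale under the predictive
distribution. -/
lemma sum_predictive_mul_integral_post_cons (hp : IsPriorDensity base p) (L : List (X × Y)) (x : X)
    {g : Θ → ℝ} (hg : Integrable g (M.post base p L)) :
    ∑ y, M.predictive base p L x y * ∫ θ, g θ ∂M.post base p ((x, y) :: L) =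
      ∫ θ, g θ ∂M.post base p L := by
  simp_rw [M.predictive_mul_integral_post_cons hp]
  rw [← integral_finsetSum]
  · simp_rw [← Finset.sum_mul, M.prob_sum, one_mul]
  · intro y _
    refine hg.mono ((M.measurable_prob x y).aestronglyMeasurable.mul hg.aestronglyMeasurable)
      (ae_of_all _ fun θ => ?_)
    rw [norm_mul, Real.norm_of_nonneg (M.prob_nonneg θ x y)]
    exact mul_le_of_le_one_left (norm_nonneg _) (M.prob_le_one θ x y)

lemma deltaQ_integral_post (hp : IsPriorDensity base p) (L : List (X × Y)) (x : X)
    {g : Θ → ℝ} (hg : Integrable g (M.post base p L)) :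
    M.deltaQ base p (fun L => ∫ θ, g θ ∂M.post base p L) L x = 0 := by
  rw [deltaQ, M.sum_predictive_mul_integral_post_cons hp L x hg, sub_self]

end Model

/-! ### Strictly proper scoring rules and entropies -/

section Simplex

variable {Y : Type*} [Fintype Y]

lemma expectedScore_eq_coe {S : (Y → ℝ) → Y → EReal} {p q : Y → ℝ}
    (htop : ∀ y, S q y ≠ ⊤) (hbot : ∀ y, p y ≠ 0 → S q y ≠ ⊥) :
    expectedScore S p q = ((∑ y, p y * (S q y).toReal : ℝ) : EReal) := by
  have hcoe : ∀ f : Y → ℝ, ((∑ y, f y : ℝ) : EReal) = ∑ y, (f y : EReal) := fun f =>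
    map_sum (⟨⟨Real.toEReal, EReal.coe_zero⟩, EReal.coe_add⟩ : ℝ →+ EReal) f Finset.univ
  rw [expectedScore, hcoe]
  refine Finset.sum_congr rfl fun y _ => ?_
  by_cases h : p y = 0
  · simp [h]
  · rw [EReal.coe_mul, EReal.coe_toReal (htop y) (hbot y h)]

lemma IsStrictlyProper.sum_lt_savageG {S : (Y → ℝ) → Y → EReal} (hS : IsStrictlyProper S)
    {u c : Y → ℝ} (hu : u ∈ stdSimplex ℝ Y) (hc : c ∈ stdSimplex ℝ Y)
    (hsupp : ∀ y, c y = 0 → u y = 0) (hne : u ≠ c) :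
    ∑ y, u y * (S c y).toReal < savageG S u := by
  have h := hS.strict u hu c hc hne.symm
  rw [expectedScore_eq_coe (hS.ne_top c hc)
      fun y hy => hS.ne_bot c hc y fun h0 => hy (hsupp y h0),
    expectedScore_eq_coe (hS.ne_top u hu) (hS.ne_bot u hu)] at h
  exact_mod_cast h

lemma IsStrictlyProper.sum_le_savageG {S : (Y → ℝ) → Y → EReal} (hS : IsStrictlyProper S)
    {u c : Y → ℝ} (hu : u ∈ stdSimplex ℝ Y) (hc : c ∈ stdSimplex ℝ Y)
    (hsupp : ∀ y, c y = 0 → u y = 0) :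
    ∑ y, u y * (S c y).toReal ≤ savageG S u := by
  by_cases h : u = c
  · rw [h]; exact le_rfl
  · exact (hS.sum_lt_savageG hu hc hsupp h).le

variable {ι : Type*} [Fintype ι]

/-- A distribution in a mixture of positive weight is supported in the support of the mixture. -/
lemma eq_zero_of_mixture_eq_zero {w : ι → ℝ} (hw : ∀ i, 0 ≤ w i) {r : ι → Y → ℝ} {c : Y → ℝ}
    (hr : ∀ i, w i ≠ 0 → r i ∈ stdSimplex ℝ Y) (hmix : ∀ y, ∑ i, w i * r i y = c y) {i : ι}
    (hi : w i ≠ 0) {y : Y} (hy : c y = 0) : r i y = 0 := by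
  have h := (Finset.sum_eq_zero_iff_of_nonneg (s := Finset.univ) (f := fun i => w i * r i y)
    fun j _ => by
      by_cases hj : w j = 0
      · simp [hj]
      · exact mul_nonneg (hw j) ((hr j hj).1 y)).1 ((hmix y).trans hy) i (Finset.mem_univ i)
  exact (mul_eq_zero.1 h).resolve_left hi

lemma savageG_mixture_eq (S : (Y → ℝ) → Y → EReal) {w : ι → ℝ} {r : ι → Y → ℝ} {c : Y → ℝ}
    (hmix : ∀ y, ∑ i, w i * r i y = c y) :
    savageG S c = ∑ i, w i * ∑ y, r i y * (S c y).toReal := by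
  simp_rw [savageG, ← hmix, Finset.sum_mul, Finset.mul_sum, mul_assoc]
  exact Finset.sum_comm

lemma IsStrictlyProper.savageG_le_sum {S : (Y → ℝ) → Y → EReal} (hS : IsStrictlyProper S)
    {w : ι → ℝ} (hw : ∀ i, 0 ≤ w i) {r : ι → Y → ℝ} {c : Y → ℝ} (hc : c ∈ stdSimplex ℝ Y)
    (hr : ∀ i, w i ≠ 0 → r i ∈ stdSimplex ℝ Y) (hmix : ∀ y, ∑ i, w i * r i y = c y) :
    savageG S c ≤ ∑ i, w i * savageG S (r i) := by
  rw [savageG_mixture_eq S hmix]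
  refine Finset.sum_le_sum fun i _ => ?_
  by_cases hi : w i = 0
  · simp [hi]
  · exact mul_le_mul_of_nonneg_left (hS.sum_le_savageG (hr i hi) hc
      fun y hy => eq_zero_of_mixture_eq_zero hw hr hmix hi hy) (hw i)

/-- The equality case of Jensen's inequality for `savageG`: it is strictly convex. -/
lemma IsStrictlyProper.eq_of_sum_le {S : (Y → ℝ) → Y → EReal} (hS : IsStrictlyProper S)
    {w : ι → ℝ} (hw : ∀ i, 0 ≤ w i) {r : ι → Y → ℝ} {c : Y → ℝ} (hc : c ∈ stdSimplex ℝ Y)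
    (hr : ∀ i, w i ≠ 0 → r i ∈ stdSimplex ℝ Y) (hmix : ∀ y, ∑ i, w i * r i y = c y)
    (hle : ∑ i, w i * savageG S (r i) ≤ savageG S c) {i : ι} (hi : w i ≠ 0) : r i = c := by
  by_contra hne
  have hsupp : ∀ j, w j ≠ 0 → ∀ y, c y = 0 → r j y = 0 :=
    fun j hj y hy => eq_zero_of_mixture_eq_zero hw hr hmix hj hy
  refine absurd hle (not_le.2 ?_)
  rw [savageG_mixture_eq S hmix]
  refine Finset.sum_lt_sum (fun j _ => ?_) ⟨i, Finset.mem_univ i, ?_⟩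
  · by_cases hj : w j = 0
    · simp [hj]
    · exact mul_le_mul_of_nonneg_left (hS.sum_le_savageG (hr j hj) hc (hsupp j hj)) (hw j)
  · exact mul_lt_mul_of_pos_left (hS.sum_lt_savageG (hr i hi) hc (hsupp i hi) hne)
      (lt_of_le_of_ne (hw i) hi.symm)

/-- The negative Shannon entropy of a distribution on the labels. -/
def negEntropy (q : Y → ℝ) : ℝ := -∑ y, Real.negMulLog (q y)

lemma continuous_negEntropy : Continuous (negEntropy (Y := Y)) := by
  unfold negEntropy
  fun_prop

/-- One term of the Kullback-Leibler divergence is at least a term of the squared Hellinger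
distance, and so at least a quarter of the squared difference. -/
lemma sq_sub_div_four_le {u c : ℝ} (hu : 0 ≤ u) (hu1 : u ≤ 1) (hc : 0 ≤ c) (hc1 : c ≤ 1)
    (h : c = 0 → u = 0) :
    (u - c) ^ 2 / 4 ≤ -Real.negMulLog u - u * Real.log c - u + c := by
  rcases hu.eq_or_lt with rfl | hu0
  · simp only [Real.negMulLog_zero]
    nlinarith
  have hc0 : 0 < c := lt_of_le_of_ne hc fun h0 => hu0.ne' (h h0.symm)
  -- The bound `log t ≤ t - 1` at `t = √c / √u` leaves `(√u - √c) ^ 2`.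
  have hlog := Real.log_le_sub_one_of_pos (div_pos (Real.sqrt_pos.2 hc0) (Real.sqrt_pos.2 hu0))
  rw [Real.log_div (Real.sqrt_pos.2 hc0).ne' (Real.sqrt_pos.2 hu0).ne', Real.log_sqrt hc,
    Real.log_sqrt hu] at hlog
  obtain ⟨a, ha, rfl⟩ : ∃ a, 0 < a ∧ u = a ^ 2 := ⟨√u, Real.sqrt_pos.2 hu0, (Real.sq_sqrt hu).symm⟩
  obtain ⟨b, hb, rfl⟩ : ∃ b, 0 < b ∧ c = b ^ 2 := ⟨√c, Real.sqrt_pos.2 hc0, (Real.sq_sqrt hc).symm⟩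
  rw [Real.sqrt_sq ha.le, Real.sqrt_sq hb.le] at hlog
  have ha1 : a ≤ 1 := by nlinarith
  have hb1 : b ≤ 1 := by nlinarith
  have hmul := mul_le_mul_of_nonneg_left hlog (sq_nonneg a)
  have e : a ^ 2 * (b / a - 1) = a * b - a ^ 2 := by field_simp
  rw [e] at hmul
  have hell : (a ^ 2 - b ^ 2) ^ 2 / 4 ≤ (a - b) ^ 2 := by
    have : (a + b) ^ 2 ≤ 4 := by nlinarith
    nlinarith [mul_le_mul_of_nonneg_left this (sq_nonneg (a - b))]
  rw [Real.negMulLog]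
  nlinarith

lemma sum_sq_le_negEntropy {u c : Y → ℝ} (hu : u ∈ stdSimplex ℝ Y) (hc : c ∈ stdSimplex ℝ Y)
    (h : ∀ y, c y = 0 → u y = 0) :
    ∑ y, (u y - c y) ^ 2 / 4 ≤ negEntropy u - ∑ y, u y * Real.log (c y) := by
  have := Finset.sum_le_sum fun y (_ : y ∈ Finset.univ) =>
    sq_sub_div_four_le (hu.1 y) ((mem_Icc_of_mem_stdSimplex hu y).2) (hc.1 y)
      ((mem_Icc_of_mem_stdSimplex hc y).2) (h y)
  simp only [Finset.sum_add_distrib, Finset.sum_sub_distrib, Finset.sum_neg_distrib, hu.2, hc.2]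
    at this
  rw [negEntropy]
  linarith

/-- A continuous function on the simplex has a modulus of continuity in terms of the squared
Euclidean distance. -/
lemma exists_sub_le_add_mul_sum_sq {G : (Y → ℝ) → ℝ} (hG : ContinuousOn G (stdSimplex ℝ Y))
    {ε : ℝ} (hε : 0 < ε) :
    ∃ K, 0 ≤ K ∧ ∀ u ∈ stdSimplex ℝ Y, ∀ c ∈ stdSimplex ℝ Y,
      G u - G c ≤ ε + K * ∑ y, (u y - c y) ^ 2 := by
  obtain ⟨C, hC⟩ := (isCompact_stdSimplex ℝ Y).exists_bound_of_continuousOn hG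
  obtain ⟨δ, hδ, h⟩ := Metric.uniformContinuousOn_iff.1
    ((isCompact_stdSimplex ℝ Y).uniformContinuousOn_of_continuous hG) ε hε
  refine ⟨2 * |C| / δ ^ 2, by positivity, fun u hu c hc => ?_⟩
  have hsum : 0 ≤ ∑ y, (u y - c y) ^ 2 := Finset.sum_nonneg fun y _ => sq_nonneg _
  by_cases hd : dist u c < δ
  · have h1 := h u hu c hc hd
    rw [Real.dist_eq] at h1
    have h2 : 0 ≤ 2 * |C| / δ ^ 2 * ∑ y, (u y - c y) ^ 2 := by positivity
    linarith [le_abs_self (G u - G c)]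
  · have hy : ∃ y, δ ≤ dist (u y) (c y) := by
      by_contra! hlt
      exact hd ((dist_pi_lt_iff hδ).2 hlt)
    obtain ⟨y, hy⟩ := hy
    have h1 : δ ^ 2 ≤ ∑ y, (u y - c y) ^ 2 := by
      refine le_trans ?_ (Finset.single_le_sum (f := fun y => (u y - c y) ^ 2)
        (fun y _ => sq_nonneg _) (Finset.mem_univ y))
      rw [← sq_abs (u y - c y), ← Real.dist_eq]
      exact pow_le_pow_left₀ hδ.le hy 2
    have h2 : 2 * |C| ≤ 2 * |C| / δ ^ 2 * ∑ y, (u y - c y) ^ 2 := by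
      rw [div_mul_eq_mul_div, le_div_iff₀ (by positivity)]
      exact mul_le_mul_of_nonneg_left h1 (by positivity)
    have h3 := hC u hu
    have h4 := hC c hc
    rw [Real.norm_eq_abs] at h3 h4
    linarith [le_abs_self (G u), neg_abs_le (G c), le_abs_self C]

end Simplex

/-! ### Predictive uncertainty and the acquisition functions -/

namespace Model

variable {Θ X Y : Type*} [MeasurableSpace Θ] [Fintype Y]
  (M : Model Θ X Y) {base : Measure Θ} {p : Θ → ℝ}

variable (base p) in
/-- The Jensen gap of a function `G` of the label distribution at `x`: its posterior mean minus its
value at the predictive. For the negative entropy this is the mutual information of the parameter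
and the label. -/
def jensenGap (G : (Y → ℝ) → ℝ) (L : List (X × Y)) (x : X) : ℝ :=
  ∫ θ, G (M.prob θ x) ∂M.post base p L - G (M.predictive base p L x)

variable (base p) in
/-- The expected increase of `G`, evaluated at the predictive at `x'`, when a label at `x` is
observed. -/
def predictiveGain (G : (Y → ℝ) → ℝ) (L : List (X × Y)) (x x' : X) : ℝ :=
  ∑ y, M.predictive base p L x y * G (M.predictive base p ((x, y) :: L) x') -
    G (M.predictive base p L x')

variable (base p) in
/-- The posterior variance of the label probability `Pr(y | θ, x)`. -/
def postVar (x : X) (y : Y) (L : List (X × Y)) : ℝ :=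
  ∫ θ, M.prob θ x y ^ 2 ∂M.post base p L - M.predictive base p L x y ^ 2

lemma measurable_comp_prob {G : (Y → ℝ) → ℝ} (hG : ContinuousOn G (stdSimplex ℝ Y)) (x : X) :
    Measurable fun θ => G (M.prob θ x) := by
  have h1 : Measurable fun θ => (⟨M.prob θ x, M.prob_mem_stdSimplex θ x⟩ : stdSimplex ℝ Y) :=
    Measurable.subtype_mk (measurable_pi_lambda _ (M.measurable_prob x))
  exact (continuousOn_iff_continuous_domRestrict.1 hG).measurable.comp h1

lemma integrable_comp_prob (hp : IsPriorDensity base p) {G : (Y → ℝ) → ℝ}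
    (hG : ContinuousOn G (stdSimplex ℝ Y)) (L : List (X × Y)) (x : X) :
    Integrable (fun θ => G (M.prob θ x)) (M.post base p L) := by
  obtain ⟨C, hC⟩ := (isCompact_stdSimplex ℝ Y).exists_bound_of_continuousOn hG
  exact M.integrable_post_of_bound hp L (M.measurable_comp_prob hG x) C
    fun θ => hC _ (M.prob_mem_stdSimplex θ x)

lemma integrable_prob_sq (hp : IsPriorDensity base p) (L : List (X × Y)) (x : X) (y : Y) :
    Integrable (fun θ => M.prob θ x y ^ 2) (M.post base p L) :=
  M.integrable_post_of_bound hp L ((M.measurable_prob x y).pow_const 2) 1 fun θ => by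
    rw [abs_of_nonneg (sq_nonneg _)]
    exact pow_le_one₀ (M.prob_nonneg θ x y) (M.prob_le_one θ x y)

lemma integral_sub_sq (hp : IsPriorDensity base p) {L : List (X × Y)}
    (hL : M.evidence base p L ≠ 0) (x : X) (y : Y) (t : ℝ) :
    ∫ θ, (M.prob θ x y - t) ^ 2 ∂M.post base p L =
      M.postVar base p x y L + (M.predictive base p L x y - t) ^ 2 := by
  have := M.isProbabilityMeasure_post hp hL
  have h1 := M.integrable_prob_sq hp L x y
  have h2 := (M.integrable_prob hp L x y).const_mul (2 * t)
  have h3 : Integrable (fun θ => M.prob θ x y ^ 2 - 2 * t * M.prob θ x y) (M.post base p L) :=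
    h1.sub h2
  have : ∀ θ, (M.prob θ x y - t) ^ 2 = M.prob θ x y ^ 2 - 2 * t * M.prob θ x y + t ^ 2 :=
    fun θ => by ring
  simp_rw [this]
  rw [integral_add h3 (integrable_const _), integral_sub h1 h2, integral_const_mul,
    ← M.predictive_eq hp, postVar]
  simp
  ring

lemma postVar_eq_integral (hp : IsPriorDensity base p) {L : List (X × Y)}
    (hL : M.evidence base p L ≠ 0) (x : X) (y : Y) :
    M.postVar base p x y L =
      ∫ θ, (M.prob θ x y - M.predictive base p L x y) ^ 2 ∂M.post base p L := by
  simp [M.integral_sub_sq hp hL]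

lemma postVar_nonneg (hp : IsPriorDensity base p) (x : X) (y : Y) (L : List (X × Y)) :
    0 ≤ M.postVar base p x y L := by
  by_cases hL : M.evidence base p L = 0
  · simp [postVar, M.post_eq_zero hL, M.predictive_eq_zero hp hL]
  · rw [M.postVar_eq_integral hp hL]
    exact integral_nonneg fun θ => sq_nonneg _

lemma sum_predictive_mul_predictive_cons (hp : IsPriorDensity base p) (L : List (X × Y))
    (x x' : X) (y' : Y) :
    ∑ y, M.predictive base p L x y * M.predictive base p ((x, y) :: L) x' y' =
      M.predictive base p L x' y' := by
  simp_rw [M.predictive_eq hp (x := x')]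
  exact M.sum_predictive_mul_integral_post_cons hp L x (M.integrable_prob hp L x' y')

/-- The acquisition function of the posterior variance of `Pr(b | θ, a)` is the mean squared
change of its posterior mean. -/
lemma deltaQ_postVar (hp : IsPriorDensity base p) {L : List (X × Y)}
    (hL : M.evidence base p L ≠ 0) (a : X) (b : Y) (x : X) :
    M.deltaQ base p (M.postVar base p a b) L x =
      ∑ y, M.predictive base p L x y *
        (M.predictive base p ((x, y) :: L) a b - M.predictive base p L a b) ^ 2 := by
  have h1 := M.sum_predictive_mul_integral_post_cons hp L x (M.integrable_prob_sq hp L a b)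
  have h2 := M.sum_predictive_mul_predictive_cons hp L x a b
  have h3 := (M.predictive_mem_stdSimplex hp hL x).2
  simp only [deltaQ, postVar, mul_sub, Finset.sum_sub_distrib, h1]
  have : ∀ y, M.predictive base p L x y *
      (M.predictive base p ((x, y) :: L) a b - M.predictive base p L a b) ^ 2 =
      M.predictive base p L x y * M.predictive base p ((x, y) :: L) a b ^ 2 -
      2 * M.predictive base p L a b *
        (M.predictive base p L x y * M.predictive base p ((x, y) :: L) a b) +
      M.predictive base p L a b ^ 2 * M.predictive base p L x y := fun y => by ring
  simp_rw [this]
  rw [Finset.sum_add_distrib, Finset.sum_sub_distrib, ← Finset.mul_sum, ← Finset.mul_sum, h2, h3]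
  ring

lemma deltaQ_eq_zero (hp : IsPriorDensity base p) {L : List (X × Y)}
    (hL : M.evidence base p L = 0) {Q : List (X × Y) → ℝ} (hQ : Q L = 0) (x : X) :
    M.deltaQ base p Q L x = 0 := by
  simp [deltaQ, hQ, M.predictive_eq_zero hp hL]

lemma postVar_eq_zero (hp : IsPriorDensity base p) {L : List (X × Y)}
    (hL : M.evidence base p L = 0) (x : X) (y : Y) : M.postVar base p x y L = 0 := by
  simp [postVar, M.post_eq_zero hL, M.predictive_eq_zero hp hL]

lemma deltaQ_postVar_nonneg (hp : IsPriorDensity base p) (a : X) (b : Y) (L : List (X × Y))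
    (x : X) : 0 ≤ M.deltaQ base p (M.postVar base p a b) L x := by
  by_cases hL : M.evidence base p L = 0
  · rw [M.deltaQ_eq_zero hp hL (M.postVar_eq_zero hp hL a b)]
  · rw [M.deltaQ_postVar hp hL]
    exact Finset.sum_nonneg fun y _ => mul_nonneg (M.predictive_nonneg hp L x y) (sq_nonneg _)

/-- Querying `x` is worthwhile for the posterior variance of the label probabilities at `x` as long
as this variance is not small: after the label `y` the posterior mean of `Pr(y | θ, x)` moves by the
variance divided by the mean. -/
lemma sq_postVar_le_deltaQ (hp : IsPriorDensity base p) (x : X) (y : Y) (L : List (X × Y)) :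
    M.postVar base p x y L ^ 2 ≤ M.deltaQ base p (M.postVar base p x y) L x := by
  by_cases hc : M.predictive base p L x y = 0
  · have : M.postVar base p x y L = 0 := by
      rw [postVar, hc, integral_eq_zero_of_ae]
      · simp
      · filter_upwards [M.prob_ae_eq_zero hp hc] with θ hθ
        simp [hθ]
    rw [this, zero_pow two_ne_zero]
    exact M.deltaQ_postVar_nonneg hp x y L x
  have hL : M.evidence base p L ≠ 0 := fun h => hc (M.predictive_eq_zero hp h x y)
  have hmem := M.predictive_mem_stdSimplex hp hL x
  have hc0 : 0 < M.predictive base p L x y := lt_of_le_of_ne (hmem.1 y) (Ne.symm hc)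
  have hc1 := (mem_Icc_of_mem_stdSimplex hmem y).2
  rw [M.deltaQ_postVar hp hL]
  refine le_trans ?_ (Finset.single_le_sum
    (f := fun b => M.predictive base p L x b *
        (M.predictive base p ((x, b) :: L) x y - M.predictive base p L x y) ^ 2)
    (fun b _ => mul_nonneg (hmem.1 b) (sq_nonneg _)) (Finset.mem_univ y))
  have h := M.predictive_mul_integral_post_cons hp L x y fun θ => M.prob θ x y
  rw [← M.predictive_eq hp] at h
  simp_rw [← sq] at h
  have hv : M.postVar base p x y L = M.predictive base p L x y *
      (M.predictive base p ((x, y) :: L) x y - M.predictive base p L x y) := by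
    rw [postVar, ← h]; ring
  rw [hv, mul_pow]
  refine mul_le_mul_of_nonneg_right ?_ (sq_nonneg _)
  nlinarith

lemma integrable_sub_predictive_sq (hp : IsPriorDensity base p) {L : List (X × Y)}
    (hL : M.evidence base p L ≠ 0) (x : X) (y : Y) :
    Integrable (fun θ => (M.prob θ x y - M.predictive base p L x y) ^ 2) (M.post base p L) :=
  M.integrable_post_of_bound hp L (((M.measurable_prob x y).sub_const _).pow_const 2) 1 fun θ => by
    have h1 := (mem_Icc_of_mem_stdSimplex (M.predictive_mem_stdSimplex hp hL x) y)
    have h2 := (mem_Icc_of_mem_stdSimplex (M.prob_mem_stdSimplex θ x) y)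
    rw [abs_of_nonneg (sq_nonneg _), sq_le_one_iff_abs_le_one, abs_le]
    constructor <;> linarith [h1.1, h1.2, h2.1, h2.2]

lemma prob_ae_support (hp : IsPriorDensity base p) (L : List (X × Y)) (x : X) :
    ∀ᵐ θ ∂M.post base p L, ∀ y, M.predictive base p L x y = 0 → M.prob θ x y = 0 := by
  refine ae_all_iff.2 fun y => ?_
  by_cases h : M.predictive base p L x y = 0
  · filter_upwards [M.prob_ae_eq_zero hp h] with θ hθ _ using hθ
  · exact ae_of_all _ fun θ h' => absurd h' h

lemma jensenGap_le (hp : IsPriorDensity base p) {G : (Y → ℝ) → ℝ}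
    (hG : ContinuousOn G (stdSimplex ℝ Y)) {L : List (X × Y)}
    (hL : M.evidence base p L ≠ 0) {ε K : ℝ}
    (hK : ∀ u ∈ stdSimplex ℝ Y, ∀ c ∈ stdSimplex ℝ Y, G u - G c ≤ ε + K * ∑ y, (u y - c y) ^ 2)
    (x : X) : M.jensenGap base p G L x ≤ ε + K * ∑ y, M.postVar base p x y L := by
  have := M.isProbabilityMeasure_post hp hL
  have hint := M.integrable_sub_predictive_sq hp hL x
  calc M.jensenGap base p G L x
      = ∫ θ, (G (M.prob θ x) - G (M.predictive base p L x)) ∂M.post base p L := by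
        rw [integral_sub (M.integrable_comp_prob hp hG L x) (integrable_const _)]
        simp [jensenGap]
    _ ≤ ∫ θ, (ε + K * ∑ y, (M.prob θ x y - M.predictive base p L x y) ^ 2) ∂M.post base p L := by
        refine integral_mono ((M.integrable_comp_prob hp hG L x).sub (integrable_const _))
          ((integrable_const _).add ((integrable_finsetSum _ fun y _ => hint y).const_mul K))
          fun θ => ?_
        exact hK _ (M.prob_mem_stdSimplex θ x) _ (M.predictive_mem_stdSimplex hp hL x)
    _ = ε + K * ∑ y, M.postVar base p x y L := by
        rw [integral_add (integrable_const _)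
          ((integrable_finsetSum _ fun y _ => hint y).const_mul K), integral_const_mul,
          integral_finsetSum _ fun y _ => hint y]
        simp [M.postVar_eq_integral hp hL]

/-- Vanishing posterior variances force the Jensen gaps to vanish, along any sequences of data and
inputs. -/
lemma tendsto_jensenGap (hp : IsPriorDensity base p) {G : (Y → ℝ) → ℝ}
    (hG : ContinuousOn G (stdSimplex ℝ Y)) {L : ℕ → List (X × Y)} {x : ℕ → X}
    (hL : ∀ n, M.evidence base p (L n) ≠ 0) (h0 : ∀ n, 0 ≤ M.jensenGap base p G (L n) (x n))
    (hvar : ∀ y, Tendsto (fun n => M.postVar base p (x n) y (L n)) atTop (𝓝 0)) :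
    Tendsto (fun n => M.jensenGap base p G (L n) (x n)) atTop (𝓝 0) := by
  refine tendsto_order.2 ⟨fun a ha => Eventually.of_forall fun n => ha.trans_le (h0 n),
    fun ε hε => ?_⟩
  obtain ⟨K, -, hK⟩ := exists_sub_le_add_mul_sum_sq hG (half_pos hε)
  have hlim : Tendsto (fun n => ε / 2 + K * ∑ y, M.postVar base p (x n) y (L n)) atTop
      (𝓝 (ε / 2 + K * ∑ _y : Y, 0)) :=
    ((tendsto_finsetSum _ fun y _ => hvar y).const_mul K).const_add _
  filter_upwards [hlim.eventually_lt_const (u := ε) (by simp; linarith)] with n hn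
  exact (M.jensenGap_le hp hG (hL n) hK (x n)).trans_lt hn

/-! #### The mutual information -/

lemma sum_postVar_le_jensenGap (hp : IsPriorDensity base p) {L : List (X × Y)}
    (hL : M.evidence base p L ≠ 0) (x : X) :
    ∑ y, M.postVar base p x y L / 4 ≤ M.jensenGap base p negEntropy L x := by
  have := M.isProbabilityMeasure_post hp hL
  have hc := M.predictive_mem_stdSimplex hp hL x
  have hG := (continuous_negEntropy (Y := Y)).continuousOn (s := stdSimplex ℝ Y)
  have hint := M.integrable_sub_predictive_sq hp hL x
  have hlog : Integrable (fun θ => ∑ y, M.prob θ x y * Real.log (M.predictive base p L x y))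
      (M.post base p L) :=
    integrable_finsetSum _ fun y _ => (M.integrable_prob hp L x y).mul_const _
  have hsupp := M.prob_ae_support hp L x
  calc ∑ y, M.postVar base p x y L / 4
      = ∫ θ, ∑ y, (M.prob θ x y - M.predictive base p L x y) ^ 2 / 4 ∂M.post base p L := by
        rw [integral_finsetSum _ fun y _ => (hint y).div_const 4]
        simp_rw [integral_div, ← M.postVar_eq_integral hp hL]
    _ ≤ ∫ θ, (negEntropy (M.prob θ x) -
          ∑ y, M.prob θ x y * Real.log (M.predictive base p L x y)) ∂M.post base p L := by
        refine integral_mono_ae (integrable_finsetSum _ fun y _ => (hint y).div_const 4)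
          ((M.integrable_comp_prob hp hG L x).sub hlog) ?_
        filter_upwards [hsupp] with θ hθ
        exact sum_sq_le_negEntropy (M.prob_mem_stdSimplex θ x) hc hθ
    _ = M.jensenGap base p negEntropy L x := by
        rw [integral_sub (M.integrable_comp_prob hp hG L x) hlog,
          integral_finsetSum _ fun y _ => (M.integrable_prob hp L x y).mul_const _, jensenGap]
        simp_rw [integral_mul_const, ← M.predictive_eq hp]
        rw [negEntropy]
        simp [Real.negMulLog]

lemma jensenGap_negEntropy_nonneg (hp : IsPriorDensity base p) {L : List (X × Y)}
    (hL : M.evidence base p L ≠ 0) (x : X) : 0 ≤ M.jensenGap base p negEntropy L x :=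
  le_trans (Finset.sum_nonneg fun y _ => div_nonneg (M.postVar_nonneg hp x y L) (by norm_num))
    (M.sum_postVar_le_jensenGap hp hL x)

lemma integrable_negMulLog_posterior (hp : IsPriorDensity base p)
    (hent : Integrable (fun θ => Real.negMulLog (p θ)) base) (L : List (X × Y)) :
    Integrable (fun θ => Real.negMulLog (M.posterior base p L θ)) base := by
  set Z := M.evidence base p L
  have hs : ∀ θ, M.posterior base p L θ = p θ * (M.likelihood L θ / Z) := fun θ => by
    rw [posterior_eq, mul_div_assoc]
  have hm : Measurable fun θ => M.likelihood L θ / Z := (M.measurable_likelihood L).div_const Z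
  have hrange : ∀ θ, M.likelihood L θ / Z ∈ Set.Icc 0 (1 / Z) := fun θ =>
    ⟨div_nonneg (M.likelihood_nonneg L θ) (M.evidence_nonneg hp L),
      div_le_div_of_nonneg_right (M.likelihood_le_one L θ) (M.evidence_nonneg hp L)⟩
  obtain ⟨C, hC⟩ := (isCompact_Icc (a := 0) (b := 1 / Z)).exists_bound_of_continuousOn
    Real.continuous_negMulLog.continuousOn
  simp_rw [hs, Real.negMulLog_mul]
  refine (hent.bdd_mul hm.aestronglyMeasurable (c := 1 / Z) (ae_of_all _ fun θ => ?_)).add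
    (hp.integrable.mul_bdd (c := C)
      (Real.continuous_negMulLog.measurable.comp hm).aestronglyMeasurable
      (ae_of_all _ fun θ => hC _ (hrange θ)))
  rw [Real.norm_of_nonneg (hrange θ).1]
  exact (hrange θ).2

/-- The entropy of the posterior after a further label, weighted by the predictive `c ≠ 0` of that
label. A posterior density `q` becomes `q * f / c`, where `f` is the probability of the label, and
`c * negMulLog (q * f / c) = f * negMulLog q + q * negMulLog f + q * f * log c`. -/
lemma predictive_mul_costI_cons (hp : IsPriorDensity base p)
    (hent : Integrable (fun θ => Real.negMulLog (p θ)) base) (L : List (X × Y)) (x : X) (y : Y) :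
    M.predictive base p L x y * M.costI base p ((x, y) :: L) =
      ∫ θ, M.prob θ x y * Real.negMulLog (M.posterior base p L θ) ∂base +
        ∫ θ, Real.negMulLog (M.prob θ x y) ∂M.post base p L -
        Real.negMulLog (M.predictive base p L x y) := by
  set c := M.predictive base p L x y with hcdef
  by_cases hc : c = 0
  · have h1 := M.prob_mul_posterior_ae_eq_zero hp hc
    have h2 := M.prob_ae_eq_zero hp hc
    rw [hc, zero_mul, Real.negMulLog_zero, integral_eq_zero_of_ae, integral_eq_zero_of_ae]
    · simp
    · filter_upwards [h2] with θ hθ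
      simp [hθ]
    · filter_upwards [h1] with θ hθ
      rcases mul_eq_zero.1 hθ with h | h <;> simp [h]
  have hi1 : Integrable (fun θ => M.prob θ x y * Real.negMulLog (M.posterior base p L θ)) base :=
    (M.integrable_negMulLog_posterior hp hent L).bdd_mul (c := 1)
      (M.measurable_prob x y).aestronglyMeasurable (ae_of_all _ fun θ => by
        rw [Real.norm_of_nonneg (M.prob_nonneg θ x y)]; exact M.prob_le_one θ x y)
  obtain ⟨C, hC⟩ := (isCompact_Icc (a := (0 : ℝ)) (b := 1)).exists_bound_of_continuousOn
    Real.continuous_negMulLog.continuousOn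
  have hi2 : Integrable (fun θ => Real.negMulLog (M.prob θ x y) * M.posterior base p L θ) base :=
    (M.integrable_posterior hp L).bdd_mul (c := C)
      (Real.continuous_negMulLog.measurable.comp (M.measurable_prob x y)).aestronglyMeasurable
      (ae_of_all _ fun θ => hC _ ⟨M.prob_nonneg θ x y, M.prob_le_one θ x y⟩)
  have hi3 : Integrable (fun θ => M.prob θ x y * M.posterior base p L θ) base :=
    (M.integrable_posterior hp L).bdd_mul (c := 1)
      (M.measurable_prob x y).aestronglyMeasurable (ae_of_all _ fun θ => by
        rw [Real.norm_of_nonneg (M.prob_nonneg θ x y)]; exact M.prob_le_one θ x y)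
  have key : ∀ θ, c * Real.negMulLog (M.posterior base p ((x, y) :: L) θ) =
      M.prob θ x y * Real.negMulLog (M.posterior base p L θ) +
        Real.negMulLog (M.prob θ x y) * M.posterior base p L θ +
        Real.log c * (M.prob θ x y * M.posterior base p L θ) := fun θ => by
    have hb := M.predictive_mul_posterior_cons hp L x y hc θ
    rw [← hcdef] at hb
    have h1 := Real.negMulLog_mul c (M.posterior base p ((x, y) :: L) θ)
    rw [hb, Real.negMulLog_mul] at h1
    have h2 : M.posterior base p ((x, y) :: L) θ * Real.negMulLog c =
        - Real.log c * (M.prob θ x y * M.posterior base p L θ) := by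
      rw [← hb, Real.negMulLog]; ring
    rw [h2] at h1
    linarith
  rw [costI, ← integral_const_mul]
  simp_rw [key]
  have hi12 : Integrable (fun θ => M.prob θ x y * Real.negMulLog (M.posterior base p L θ) +
      Real.negMulLog (M.prob θ x y) * M.posterior base p L θ) base := hi1.add hi2
  rw [integral_add hi12 (hi3.const_mul _), integral_add hi1 hi2, integral_const_mul,
    M.integral_post hp]
  have hc' : ∫ θ, M.prob θ x y * M.posterior base p L θ ∂base = c := rfl
  rw [hc', Real.negMulLog]
  ring

/-- The BALD acquisition function is the mutual information of the parameter and the label. -/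
lemma deltaQ_costI (hp : IsPriorDensity base p)
    (hent : Integrable (fun θ => Real.negMulLog (p θ)) base) (L : List (X × Y)) (x : X) :
    M.deltaQ base p (M.costI base p) L x = M.jensenGap base p negEntropy L x := by
  have hi := M.integrable_negMulLog_posterior hp hent L
  simp_rw [deltaQ, M.predictive_mul_costI_cons hp hent]
  rw [Finset.sum_sub_distrib, Finset.sum_add_distrib, ← integral_finsetSum, ← integral_finsetSum]
  · simp_rw [← Finset.sum_mul, M.prob_sum, one_mul]
    rw [jensenGap, costI]
    simp only [negEntropy, integral_neg]
    ring
  · exact fun y _ => M.integrable_post_of_bound hp L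
      (Real.continuous_negMulLog.measurable.comp (M.measurable_prob x y)) 1 fun θ => by
        have h0 := Real.negMulLog_nonneg (M.prob_nonneg θ x y) (M.prob_le_one θ x y)
        rw [abs_of_nonneg h0]
        have := sq_sub_div_four_le (M.prob_nonneg θ x y) (M.prob_le_one θ x y) zero_le_one le_rfl
          (fun h => absurd h one_ne_zero)
        have h2 := M.prob_nonneg θ x y
        simp only [Real.log_one, mul_zero] at this
        nlinarith [sq_nonneg (M.prob θ x y - 1)]
  · exact fun y _ => hi.bdd_mul (c := 1)
      (M.measurable_prob x y).aestronglyMeasurable (ae_of_all _ fun θ => by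
        rw [Real.norm_of_nonneg (M.prob_nonneg θ x y)]; exact M.prob_le_one θ x y)

/-! #### The expected score difference -/

lemma savageG_zero (S : (Y → ℝ) → Y → EReal) : savageG S 0 = 0 := by simp [savageG]

lemma jensenGap_eq_zero (hp : IsPriorDensity base p) {L : List (X × Y)}
    (hL : M.evidence base p L = 0) (S : (Y → ℝ) → Y → EReal) (x : X) :
    M.jensenGap base p (savageG S) L x = 0 := by
  have : M.predictive base p L x = 0 := funext fun y => M.predictive_eq_zero hp hL x y
  rw [jensenGap, this, savageG_zero, M.post_eq_zero hL, integral_zero_measure, sub_zero]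

lemma jensenGap_savageG_nonneg (hp : IsPriorDensity base p) {S : (Y → ℝ) → Y → EReal}
    (hS : IsStrictlyProper S) (hG : ContinuousOn (savageG S) (stdSimplex ℝ Y))
    (L : List (X × Y)) (x : X) : 0 ≤ M.jensenGap base p (savageG S) L x := by
  by_cases hL : M.evidence base p L = 0
  · rw [M.jensenGap_eq_zero hp hL]
  have hsupp := M.prob_ae_support hp L x
  have hint : ∀ y, Integrable (fun θ => M.prob θ x y * (S (M.predictive base p L x) y).toReal)
      (M.post base p L) := fun y => (M.integrable_prob hp L x y).mul_const _
  have hmean : savageG S (M.predictive base p L x) =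
      ∫ θ, ∑ y, M.prob θ x y * (S (M.predictive base p L x) y).toReal ∂M.post base p L := by
    rw [integral_finsetSum _ fun y _ => hint y]
    simp_rw [integral_mul_const, ← M.predictive_eq hp]
    rfl
  rw [jensenGap, sub_nonneg, hmean]
  refine integral_mono_ae (integrable_finsetSum _ fun y _ => hint y)
    (M.integrable_comp_prob hp hG L x) ?_
  filter_upwards [hsupp] with θ hθ
  exact hS.sum_le_savageG (M.prob_mem_stdSimplex θ x) (M.predictive_mem_stdSimplex hp hL x) hθ

lemma predictiveGain_nonneg (hp : IsPriorDensity base p) {S : (Y → ℝ) → Y → EReal}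
    (hS : IsStrictlyProper S) (L : List (X × Y)) (x x' : X) :
    0 ≤ M.predictiveGain base p (savageG S) L x x' := by
  by_cases hL : M.evidence base p L = 0
  · have : M.predictive base p L x' = 0 := funext fun y => M.predictive_eq_zero hp hL x' y
    simp [predictiveGain, this, savageG_zero, M.predictive_eq_zero hp hL x]
  refine sub_nonneg.2 (hS.savageG_le_sum (M.predictive_nonneg hp L x)
    (M.predictive_mem_stdSimplex hp hL x') (fun y hy => ?_)
    (M.sum_predictive_mul_predictive_cons hp L x x'))
  refine M.predictive_mem_stdSimplex hp ?_ x'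
  rw [M.evidence_cons hp]
  exact mul_ne_zero hL hy

variable [Fintype X]

lemma costS_eq (hp : IsPriorDensity base p) (px : X → ℝ) {S : (Y → ℝ) → Y → EReal}
    (hG : ContinuousOn (savageG S) (stdSimplex ℝ Y)) (L : List (X × Y)) :
    M.costS base p px S L = ∑ x, px x * M.jensenGap base p (savageG S) L x := by
  refine Finset.sum_congr rfl fun x _ => ?_
  congr 1
  have hint : ∀ y, Integrable (fun θ => M.prob θ x y * (S (M.predictive base p L x) y).toReal)
      (M.post base p L) := fun y => (M.integrable_prob hp L x y).mul_const _
  rw [← M.integral_post hp]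
  simp_rw [mul_sub, Finset.sum_sub_distrib]
  have hG' := M.integrable_comp_prob hp hG L x
  rw [jensenGap]
  simp only [savageG] at hG' ⊢
  rw [integral_sub hG' (integrable_finsetSum _ fun y _ => hint y),
    integral_finsetSum _ fun y _ => hint y]
  simp_rw [integral_mul_const, ← M.predictive_eq hp]

lemma costS_nonneg (hp : IsPriorDensity base p) {px : X → ℝ} (hpx : ∀ x, 0 ≤ px x)
    {S : (Y → ℝ) → Y → EReal} (hS : IsStrictlyProper S)
    (hG : ContinuousOn (savageG S) (stdSimplex ℝ Y)) (L : List (X × Y)) :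
    0 ≤ M.costS base p px S L := by
  rw [M.costS_eq hp px hG]
  exact Finset.sum_nonneg fun x _ => mul_nonneg (hpx x) (M.jensenGap_savageG_nonneg hp hS hG L x)

/-- The BEMPS acquisition function is the mean, over the inputs, of the expected gain of the
generalized negative entropy of the predictive. -/
lemma deltaQ_costS (hp : IsPriorDensity base p) (px : X → ℝ) {S : (Y → ℝ) → Y → EReal}
    (hG : ContinuousOn (savageG S) (stdSimplex ℝ Y)) (L : List (X × Y)) (x : X) :
    M.deltaQ base p (M.costS base p px S) L x =
      ∑ x', px x' * M.predictiveGain base p (savageG S) L x x' := by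
  simp_rw [deltaQ, M.costS_eq hp px hG, Finset.mul_sum]
  rw [Finset.sum_comm, ← Finset.sum_sub_distrib]
  refine Finset.sum_congr rfl fun x' _ => ?_
  have h := M.sum_predictive_mul_integral_post_cons hp L x (M.integrable_comp_prob hp hG L x')
  have h' : ∑ y, M.predictive base p L x y *
      (px x' * M.jensenGap base p (savageG S) ((x, y) :: L) x') = px x' *
      (∑ y, M.predictive base p L x y *
        ∫ θ, savageG S (M.prob θ x') ∂M.post base p ((x, y) :: L) -
      ∑ y, M.predictive base p L x y * savageG S (M.predictive base p ((x, y) :: L) x')) := by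
    rw [← Finset.sum_sub_distrib, Finset.mul_sum]
    refine Finset.sum_congr rfl fun y _ => ?_
    rw [jensenGap]; ring
  rw [h', h, jensenGap, predictiveGain]
  ring

lemma deltaQ_costS_nonneg (hp : IsPriorDensity base p) {px : X → ℝ} (hpx : ∀ x, 0 ≤ px x)
    {S : (Y → ℝ) → Y → EReal} (hS : IsStrictlyProper S)
    (hG : ContinuousOn (savageG S) (stdSimplex ℝ Y)) (L : List (X × Y)) (x : X) :
    0 ≤ M.deltaQ base p (M.costS base p px S) L x := by
  rw [M.deltaQ_costS hp px hG]
  exact Finset.sum_nonneg fun x' _ => mul_nonneg (hpx x') (M.predictiveGain_nonneg hp hS L x x')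

end Model

/-! ### The evidence ratio -/

namespace Model

variable {Θ X Y : Type*} [MeasurableSpace Θ] [Fintype Y]
  (M : Model Θ X Y) {base : Measure Θ} {p : Θ → ℝ}

variable (base p) in
/-- The ratio of the evidence to the likelihood of `θr`. On data possible under `θr` it is the
density of the Bayesian law of the data, in which the parameter is drawn from the prior, with
respect to the true law; on other data it is the junk value `0`. -/
def evidenceRatio (θr : Θ) (L : List (X × Y)) : ℝ :=
  M.evidence base p L / M.likelihood L θr

lemma evidenceRatio_nonneg (hp : IsPriorDensity base p) (θr : Θ) (L : List (X × Y)) :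
    0 ≤ M.evidenceRatio base p θr L :=
  div_nonneg (M.evidence_nonneg hp L) (M.likelihood_nonneg L θr)

lemma evidenceRatio_nil (hp : IsPriorDensity base p) (θr : Θ) :
    M.evidenceRatio base p θr [] = 1 := by
  simp [evidenceRatio, M.evidence_nil hp]

lemma prob_mul_evidenceRatio_cons_le (hp : IsPriorDensity base p) (θr : Θ) (L : List (X × Y))
    (x : X) (y : Y) :
    M.prob θr x y * M.evidenceRatio base p θr ((x, y) :: L) ≤
      M.evidenceRatio base p θr L * M.predictive base p L x y := by
  by_cases h : M.prob θr x y = 0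
  · rw [h, zero_mul]
    exact mul_nonneg (M.evidenceRatio_nonneg hp θr L) (M.predictive_nonneg hp L x y)
  · rw [evidenceRatio, evidenceRatio, M.evidence_cons hp, likelihood_cons]
    refine le_of_eq ?_
    field_simp

/-- A change of measure: under the true label distribution, a nonnegative cost weighted by the
evidence ratio decreases in the mean at least by the weighted acquisition function. -/
lemma sum_prob_mul_evidenceRatio_mul_le (hp : IsPriorDensity base p) (θr : Θ)
    {Q : List (X × Y) → ℝ} (hQ : ∀ L, 0 ≤ Q L) (L : List (X × Y)) (x : X) :
    ∑ y, M.prob θr x y * (M.evidenceRatio base p θr ((x, y) :: L) * Q ((x, y) :: L)) ≤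
      M.evidenceRatio base p θr L * Q L -
        M.evidenceRatio base p θr L * M.deltaQ base p Q L x := by
  have h : M.evidenceRatio base p θr L * Q L -
      M.evidenceRatio base p θr L * M.deltaQ base p Q L x =
      ∑ y, M.evidenceRatio base p θr L * M.predictive base p L x y * Q ((x, y) :: L) := by
    simp_rw [deltaQ, mul_assoc, ← Finset.mul_sum]
    ring
  rw [h]
  refine Finset.sum_le_sum fun y _ => ?_
  rw [← mul_assoc]
  exact mul_le_mul_of_nonneg_right (M.prob_mul_evidenceRatio_cons_le hp θr L x y) (hQ _)

variable [MeasurableSingletonClass Θ]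

lemma post_real_singleton (hp : IsPriorDensity base p) (θr : Θ) (L : List (X × Y)) :
    (M.post base p L).real {θr} =
      (∫ θ in {θr}, p θ ∂base) * M.likelihood L θr / M.evidence base p L := by
  rw [M.post_real_apply hp L (measurableSet_singleton θr), ← integral_mul_const,
    ← integral_div]
  refine setIntegral_congr_fun (measurableSet_singleton θr) fun θ hθ => ?_
  rw [Set.mem_singleton_iff.1 hθ, posterior_eq]

lemma prior_mul_likelihood_le_evidence (hp : IsPriorDensity base p) (θr : Θ)
    (L : List (X × Y)) :
    (∫ θ in {θr}, p θ ∂base) * M.likelihood L θr ≤ M.evidence base p L := by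
  rw [← integral_mul_const]
  calc ∫ θ in {θr}, p θ * M.likelihood L θr ∂base
      = ∫ θ in {θr}, p θ * M.likelihood L θ ∂base :=
        setIntegral_congr_fun (measurableSet_singleton θr) fun θ hθ => by
          rw [Set.mem_singleton_iff.1 hθ]
    _ ≤ M.evidence base p L :=
        setIntegral_le_integral (M.integrable_prior_mul_likelihood hp L)
          (ae_of_all _ fun θ => mul_nonneg (hp.nonneg θ) (M.likelihood_nonneg L θ))

lemma evidence_ne_zero (hp : IsPriorDensity base p) {θr : Θ}
    (hθr : 0 < ∫ θ in {θr}, p θ ∂base) {L : List (X × Y)} (hL : M.likelihood L θr ≠ 0) :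
    M.evidence base p L ≠ 0 :=
  ((mul_pos hθr (lt_of_le_of_ne (M.likelihood_nonneg L θr) hL.symm)).trans_le
    (M.prior_mul_likelihood_le_evidence hp θr L)).ne'

lemma prior_le_evidenceRatio (hp : IsPriorDensity base p) (θr : Θ) {L : List (X × Y)}
    (hL : M.likelihood L θr ≠ 0) :
    ∫ θ in {θr}, p θ ∂base ≤ M.evidenceRatio base p θr L :=
  (le_div_iff₀ (lt_of_le_of_ne (M.likelihood_nonneg L θr) hL.symm)).2
    (M.prior_mul_likelihood_le_evidence hp θr L)

/-- The positive posterior mass of `θr` bounds the squared error of the label probabilities with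
respect to `θr` in terms of their posterior variance. -/
lemma integral_sub_sq_le (hp : IsPriorDensity base p) {θr : Θ}
    (hθr : 0 < ∫ θ in {θr}, p θ ∂base) {L : List (X × Y)} (hL : M.likelihood L θr ≠ 0)
    (x : X) (y : Y) :
    ∫ θ, (M.prob θ x y - M.prob θr x y) ^ 2 ∂M.post base p L ≤
      M.postVar base p x y L *
        (1 + M.evidenceRatio base p θr L / ∫ θ in {θr}, p θ ∂base) := by
  have hZ := M.evidence_ne_zero hp hθr hL
  have hR := hθr.trans_le (M.prior_le_evidenceRatio hp θr hL)
  have := M.isProbabilityMeasure_post hp hZ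
  set w := ∫ θ in {θr}, p θ ∂base
  have hmass : (M.post base p L).real {θr} = w / M.evidenceRatio base p θr L := by
    rw [M.post_real_singleton hp, evidenceRatio, div_div_eq_mul_div]
  have h : w / M.evidenceRatio base p θr L *
      (M.prob θr x y - M.predictive base p L x y) ^ 2 ≤ M.postVar base p x y L := by
    rw [M.postVar_eq_integral hp hZ, ← hmass]
    calc _ = ∫ θ in {θr}, (M.prob θr x y - M.predictive base p L x y) ^ 2 ∂M.post base p L := by
          rw [setIntegral_const, smul_eq_mul]
      _ = ∫ θ in {θr}, (M.prob θ x y - M.predictive base p L x y) ^ 2 ∂M.post base p L :=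
          setIntegral_congr_fun (measurableSet_singleton θr) fun θ hθ => by
            rw [Set.mem_singleton_iff.1 hθ]
      _ ≤ _ := setIntegral_le_integral (M.integrable_sub_predictive_sq hp hZ x y)
          (ae_of_all _ fun θ => sq_nonneg _)
  rw [M.integral_sub_sq hp hZ, mul_add, mul_one]
  have h' : (M.predictive base p L x y - M.prob θr x y) ^ 2 =
      w / M.evidenceRatio base p θr L * (M.prob θr x y - M.predictive base p L x y) ^ 2 *
        (M.evidenceRatio base p θr L / w) := by
    field_simp
    ring
  rw [h']
  gcongr

end Model

/-! ### Processes along a run -/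

section Run

variable {Θ X Y Ω : Type*} [MeasurableSpace Θ] [Fintype X] [Fintype Y] {m : MeasurableSpace Ω}
  {M : Model Θ X Y} {base : Measure Θ} {p : Θ → ℝ} {θr : Θ} {acq : List (X × Y) → X → ℝ}
  {μ : Measure Ω} {ℱ : Filtration ℕ m} {x : ℕ → Ω → X} {y : ℕ → Ω → Y}

/-- The data after `n` steps, as a function of the sample point. -/
abbrev data (x : ℕ → Ω → X) (y : ℕ → Ω → Y) (n : ℕ) (ω : Ω) : List (X × Y) :=
  labelled (x · ω) (y · ω) n

omit [Fintype X] [Fintype Y] m in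
lemma length_data (x : ℕ → Ω → X) (y : ℕ → Ω → Y) (n : ℕ) (ω : Ω) :
    (data x y n ω).length = n := by
  induction n with
  | zero => rfl
  | succ n ih => simp [data, labelled, ih]

omit [Fintype X] in
lemma IsRun.measurableSet_data_eq (h : IsRun M θr acq μ ℱ x y) (n : ℕ) (l : List (X × Y)) :
    MeasurableSet[ℱ n] {ω | data x y n ω = l} := by
  induction n generalizing l with
  | zero => exact MeasurableSet.const ([] = l)
  | succ n ih =>
    cases l with
    | nil => simp [data, labelled]
    | cons z l =>
      have : {ω | data x y (n + 1) ω = z :: l} =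
          ({ω | x n ω = z.1} ∩ {ω | y n ω = z.2}) ∩ {ω | data x y n ω = l} := by
        ext ω
        simp [data, labelled, Prod.ext_iff]
      rw [this]
      exact ((ℱ.mono n.le_succ _ (h.input_adapted n z.1)).inter (h.label_adapted n z.2)).inter
        (ℱ.mono n.le_succ _ (ih l))

lemma IsRun.measurable_comp (h : IsRun M θr acq μ ℱ x y) (n : ℕ)
    (g : List (X × Y) → X → ℝ) : Measurable[ℱ n] fun ω => g (data x y n ω) (x n ω) := by
  let _ : MeasurableSpace (List (X × Y) × X) := ⊤
  have h1 : Measurable[ℱ n] fun ω => (data x y n ω, x n ω) := by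
    refine @measurable_to_countable' _ _ _ _ (ℱ n) _ fun z => ?_
    have : (fun ω => (data x y n ω, x n ω)) ⁻¹' {z} =
        {ω | data x y n ω = z.1} ∩ {ω | x n ω = z.2} := by
      ext ω
      simp [Prod.ext_iff]
    rw [this]
    exact (h.measurableSet_data_eq n z.1).inter (h.input_adapted n z.2)
  have h2 : Measurable fun z : List (X × Y) × X => g z.1 z.2 := measurable_from_top
  exact h2.comp h1

omit m in
lemma exists_bound_comp (x : ℕ → Ω → X) (y : ℕ → Ω → Y) (n : ℕ) (g : List (X × Y) → X → ℝ) :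
    ∃ C, ∀ ω, ‖g (data x y n ω) (x n ω)‖ ≤ C := by
  obtain ⟨C, hC⟩ := (((List.finite_length_eq (X × Y) n).prod
    (Set.finite_univ (α := X))).image fun z => ‖g z.1 z.2‖).bddAbove
  exact ⟨C, fun ω => hC ⟨(data x y n ω, x n ω), ⟨length_data x y n ω, Set.mem_univ _⟩, rfl⟩⟩

lemma IsRun.integrable_comp [IsFiniteMeasure μ] (h : IsRun M θr acq μ ℱ x y) (n : ℕ)
    (g : List (X × Y) → X → ℝ) : Integrable (fun ω => g (data x y n ω) (x n ω)) μ := by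
  obtain ⟨C, hC⟩ := exists_bound_comp x y n g
  exact Integrable.of_bound ((h.measurable_comp n g).mono (ℱ.le n) le_rfl).aestronglyMeasurable C
    (ae_of_all _ hC)

/-- The conditional expectation of a function of the data after one more step. -/
lemma IsRun.condExp_data_succ [IsProbabilityMeasure μ] (h : IsRun M θr acq μ ℱ x y) (n : ℕ)
    (g : List (X × Y) → ℝ) :
    μ[fun ω => g (data x y (n + 1) ω) | ℱ n] =ᵐ[μ]
      fun ω => ∑ b, M.prob θr (x n ω) b * g ((x n ω, b) :: data x y n ω) := by
  let f : Y → Ω → ℝ := fun b ω => g ((x n ω, b) :: data x y n ω)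
  let e : Y → Ω → ℝ := fun b => Set.indicator {ω | y n ω = b} fun _ => (1 : ℝ)
  have hf : ∀ b, StronglyMeasurable[ℱ n] (f b) := fun b =>
    (h.measurable_comp n fun l a => g ((a, b) :: l)).stronglyMeasurable
  have he : ∀ b, Integrable (e b) μ := fun b =>
    (integrable_const (1 : ℝ)).indicator (ℱ.le (n + 1) _ (h.label_adapted n b))
  have hbound : ∀ b, ∃ C, ∀ ω, ‖f b ω‖ ≤ C := fun b =>
    exists_bound_comp x y n fun l a => g ((a, b) :: l)
  have hfe : ∀ b, Integrable (f b * e b) μ := fun b => by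
    obtain ⟨C, hC⟩ := hbound b
    exact (he b).bdd_mul ((hf b).mono (ℱ.le n)).aestronglyMeasurable (ae_of_all _ hC)
  have hsum : (fun ω => g (data x y (n + 1) ω)) = ∑ b, f b * e b := by
    classical
    funext ω
    simp [f, e, Set.indicator_apply, data, labelled]
  have hpull : ∀ b, μ[f b * e b | ℱ n] =ᵐ[μ] fun ω => f b ω * M.prob θr (x n ω) b := fun b => by
    filter_upwards [condExp_mul_of_stronglyMeasurable_left (hf b) (hfe b) (he b),
      h.label_law n b] with ω h1 h2
    rw [h1, Pi.mul_apply, h2]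
  rw [hsum]
  refine (condExp_finsetSum (fun b _ => hfe b) (ℱ n)).trans ?_
  filter_upwards [ae_all_iff.2 hpull] with ω hω
  rw [Finset.sum_apply]
  exact Finset.sum_congr rfl fun b _ => by rw [hω b, mul_comm]

/-- Almost surely only labels of positive true probability are received. -/
lemma IsRun.ae_likelihood_ne_zero [IsProbabilityMeasure μ] (h : IsRun M θr acq μ ℱ x y) :
    ∀ᵐ ω ∂μ, ∀ n, M.likelihood (data x y n ω) θr ≠ 0 := by
  classical
  have hstep : ∀ n, ∀ᵐ ω ∂μ, M.prob θr (x n ω) (y n ω) ≠ 0 := fun n => by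
    -- The indicator of data whose latest label is impossible under `θr`.
    let g : List (X × Y) → ℝ := fun l => match l with
      | [] => 0
      | z :: _ => if M.prob θr z.1 z.2 = 0 then 1 else 0
    have hg : ∀ l, 0 ≤ g l := fun l => by
      cases l with
      | nil => exact le_rfl
      | cons z l => simp only [g]; split_ifs <;> norm_num
    have hint : Integrable (fun ω => g (data x y (n + 1) ω)) μ :=
      h.integrable_comp (n + 1) fun l _ => g l
    have hzero : ∫ ω, g (data x y (n + 1) ω) ∂μ = 0 := by
      rw [← integral_condExp (ℱ.le n), integral_congr_ae (h.condExp_data_succ n g)]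
      have : ∀ ω, ∑ b, M.prob θr (x n ω) b * g ((x n ω, b) :: data x y n ω) = 0 := fun ω =>
        Finset.sum_eq_zero fun b _ => by
          by_cases hb : M.prob θr (x n ω) b = 0 <;> simp [g, hb]
      simp [this]
    have hnn : ∀ ω, 0 ≤ g (data x y (n + 1) ω) := fun ω => hg (data x y (n + 1) ω)
    filter_upwards [(integral_eq_zero_iff_of_nonneg hnn hint).1 hzero] with ω hω h0
    simp [g, data, labelled, h0] at hω
  filter_upwards [ae_all_iff.2 hstep] with ω hω n
  induction n with
  | zero => simp [data, labelled]
  | succ n ih => simpa [data, labelled] using ⟨hω n, ih⟩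

variable (M base p θr) in
/-- The compensated process of a cost: the weighted cost plus the accumulated weighted values of
the acquisition function at the queried inputs. -/
def compensated (Q : List (X × Y) → ℝ) (x : ℕ → Ω → X) (y : ℕ → Ω → Y) (n : ℕ) (ω : Ω) : ℝ :=
  M.evidenceRatio base p θr (data x y n ω) * Q (data x y n ω) +
    ∑ k ∈ Finset.range n, M.evidenceRatio base p θr (data x y k ω) *
      M.deltaQ base p Q (data x y k ω) (x k ω)

lemma IsRun.supermartingale_compensated [IsProbabilityMeasure μ] (h : IsRun M θr acq μ ℱ x y)
    (hp : IsPriorDensity base p) {Q : List (X × Y) → ℝ} (hQ : ∀ L, 0 ≤ Q L) :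
    Supermartingale (compensated M base p θr Q x y) ℱ μ := by
  let G : List (X × Y) → ℝ := fun L => M.evidenceRatio base p θr L * Q L
  let D : List (X × Y) → X → ℝ := fun L a =>
    M.evidenceRatio base p θr L * M.deltaQ base p Q L a
  have hsm : ∀ k n, k ≤ n → StronglyMeasurable[ℱ n] fun ω => D (data x y k ω) (x k ω) :=
    fun k n hkn => (h.measurable_comp k D).stronglyMeasurable.mono (ℱ.mono hkn)
  have hGm : ∀ n, StronglyMeasurable[ℱ n] fun ω => G (data x y n ω) :=
    fun n => (h.measurable_comp n fun l _ => G l).stronglyMeasurable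
  have hGi : ∀ n, Integrable (fun ω => G (data x y n ω)) μ :=
    fun n => h.integrable_comp n fun l _ => G l
  have hSi : ∀ n, Integrable (fun ω => ∑ k ∈ Finset.range n, D (data x y k ω) (x k ω)) μ :=
    fun n => integrable_finsetSum _ fun k _ => h.integrable_comp k D
  refine supermartingale_nat (fun n => ?_) (fun n => (hGi n).add (hSi n)) fun n => ?_
  · exact (hGm n).add (Finset.stronglyMeasurable_fun_sum _ fun k hk =>
      hsm k n (Finset.mem_range.1 hk).le)
  · have hSm : StronglyMeasurable[ℱ n]
        fun ω => ∑ k ∈ Finset.range (n + 1), D (data x y k ω) (x k ω) :=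
      Finset.stronglyMeasurable_fun_sum _ fun k hk =>
        hsm k n (Nat.lt_succ_iff.1 (Finset.mem_range.1 hk))
    have hadd : μ[compensated M base p θr Q x y (n + 1) | ℱ n] =ᵐ[μ] _ :=
      condExp_add (hGi (n + 1)) (hSi (n + 1)) (ℱ n)
    rw [condExp_of_stronglyMeasurable (ℱ.le n) hSm (hSi (n + 1))] at hadd
    filter_upwards [hadd, h.condExp_data_succ n G] with ω h1 h2
    rw [h1, Pi.add_apply, h2, compensated, Finset.sum_range_succ]
    have := M.sum_prob_mul_evidenceRatio_mul_le hp θr hQ (data x y n ω) (x n ω)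
    simp only [G, D] at this ⊢
    linarith

omit [Fintype X] m in
lemma compensated_zero (hp : IsPriorDensity base p) (Q : List (X × Y) → ℝ) (ω : Ω) :
    compensated M base p θr Q x y 0 ω = Q [] := by
  simp [compensated, data, labelled, M.evidenceRatio_nil hp]

omit [Fintype X] m in
lemma weighted_le_compensated (hp : IsPriorDensity base p) {Q : List (X × Y) → ℝ}
    (hΔ : ∀ L a, 0 ≤ M.deltaQ base p Q L a) (n : ℕ) (ω : Ω) :
    M.evidenceRatio base p θr (data x y n ω) * Q (data x y n ω) ≤
      compensated M base p θr Q x y n ω :=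
  le_add_of_nonneg_right (Finset.sum_nonneg fun _ _ =>
    mul_nonneg (M.evidenceRatio_nonneg hp θr _) (hΔ _ _))

lemma IsRun.integral_compensated_le [IsProbabilityMeasure μ] (h : IsRun M θr acq μ ℱ x y)
    (hp : IsPriorDensity base p) {Q : List (X × Y) → ℝ} (hQ : ∀ L, 0 ≤ Q L) (n : ℕ) :
    ∫ ω, compensated M base p θr Q x y n ω ∂μ ≤ Q [] := by
  have := (h.supermartingale_compensated hp hQ).setIntegral_le (Nat.zero_le n) MeasurableSet.univ
  simpa [compensated_zero hp] using this

lemma IsRun.lintegral_weighted_le [IsProbabilityMeasure μ] (h : IsRun M θr acq μ ℱ x y)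
    (hp : IsPriorDensity base p) {Q : List (X × Y) → ℝ} (hQ : ∀ L, 0 ≤ Q L)
    (hΔ : ∀ L a, 0 ≤ M.deltaQ base p Q L a) (n : ℕ) :
    ∫⁻ ω, ENNReal.ofReal (M.evidenceRatio base p θr (data x y n ω) * Q (data x y n ω)) ∂μ ≤
      ENNReal.ofReal (Q []) := by
  have hi : Integrable (fun ω => M.evidenceRatio base p θr (data x y n ω) * Q (data x y n ω)) μ :=
    h.integrable_comp n fun l _ => M.evidenceRatio base p θr l * Q l
  rw [← ofReal_integral_eq_lintegral_ofReal hi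
    (ae_of_all _ fun ω => mul_nonneg (M.evidenceRatio_nonneg hp θr _) (hQ _))]
  refine ENNReal.ofReal_le_ofReal (le_trans ?_ (h.integral_compensated_le hp hQ n))
  exact integral_mono hi ((h.supermartingale_compensated hp hQ).integrable n)
    (weighted_le_compensated hp hΔ n)

/-- For a nonnegative cost with nonnegative acquisition function, almost surely the weighted cost
converges and the acquisition function at the queried inputs tends to `0`. -/
lemma IsRun.ae_tendsto [MeasurableSingletonClass Θ] [IsProbabilityMeasure μ]
    (h : IsRun M θr acq μ ℱ x y) (hp : IsPriorDensity base p)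
    (hθr : 0 < ∫ θ in {θr}, p θ ∂base) {Q : List (X × Y) → ℝ} (hQ : ∀ L, 0 ≤ Q L)
    (hΔ : ∀ L a, 0 ≤ M.deltaQ base p Q L a) :
    ∀ᵐ ω ∂μ,
      (∃ c, Tendsto (fun n => M.evidenceRatio base p θr (data x y n ω) * Q (data x y n ω))
        atTop (𝓝 c)) ∧
      Tendsto (fun n => M.deltaQ base p Q (data x y n ω) (x n ω)) atTop (𝓝 0) := by
  have hsuper := h.supermartingale_compensated hp hQ
  have hGnn : ∀ n ω, 0 ≤ M.evidenceRatio base p θr (data x y n ω) * Q (data x y n ω) :=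
    fun n ω => mul_nonneg (M.evidenceRatio_nonneg hp θr _) (hQ _)
  have hnn : ∀ n ω, 0 ≤ compensated M base p θr Q x y n ω := fun n ω =>
    (hGnn n ω).trans (weighted_le_compensated hp hΔ n ω)
  have hbdd : ∀ n, eLpNorm ((-compensated M base p θr Q x y) n) 1 μ ≤ (Q []).toNNReal := fun n => by
    rw [Pi.neg_apply, eLpNorm_neg, eLpNorm_one_eq_lintegral_enorm]
    simp_rw [Real.enorm_of_nonneg (hnn n _)]
    rw [← ofReal_integral_eq_lintegral_ofReal (hsuper.integrable n) (ae_of_all _ (hnn n))]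
    exact ENNReal.ofReal_le_ofReal (h.integral_compensated_le hp hQ n)
  filter_upwards [hsuper.neg.exists_ae_tendsto_of_bdd hbdd, h.ae_likelihood_ne_zero]
    with ω ⟨c, hc⟩ hlik
  have hW : Tendsto (fun n => compensated M base p θr Q x y n ω) atTop (𝓝 (-c)) := by
    simpa using hc.neg
  -- The partial sums of `D` are bounded by the convergent compensated process.
  let D : ℕ → ℝ := fun k => M.evidenceRatio base p θr (data x y k ω) *
    M.deltaQ base p Q (data x y k ω) (x k ω)
  have hD : ∀ k, 0 ≤ D k := fun k => mul_nonneg (M.evidenceRatio_nonneg hp θr _) (hΔ _ _)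
  have hsumm : Summable D := by
    obtain ⟨C, hC⟩ := hW.bddAbove_range
    refine summable_of_sum_range_le hD (c := C) fun n => ?_
    exact (le_add_of_nonneg_left (hGnn n ω)).trans (hC ⟨n, rfl⟩)
  refine ⟨⟨-c - ∑' k, D k, ?_⟩, ?_⟩
  · refine (hW.sub hsumm.hasSum.tendsto_sum_nat).congr fun n => ?_
    simp [compensated, D]
  · have hlim := hsumm.tendsto_atTop_zero.div_const (∫ θ in {θr}, p θ ∂base)
    rw [zero_div] at hlim
    refine squeeze_zero (fun n => hΔ _ _) (fun n => ?_) hlim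
    rw [le_div_iff₀ hθr, mul_comm]
    exact mul_le_mul_of_nonneg_right (M.prior_le_evidenceRatio hp θr (hlik n)) (hΔ _ _)

/-- The martingale convergence of posterior expectations, weighted by the evidence ratio. -/
lemma IsRun.ae_exists_tendsto_weighted_integral [MeasurableSingletonClass Θ]
    [IsProbabilityMeasure μ] (h : IsRun M θr acq μ ℱ x y) (hp : IsPriorDensity base p)
    (hθr : 0 < ∫ θ in {θr}, p θ ∂base) {f : Θ → ℝ} (hf : Measurable f) (hf0 : ∀ θ, 0 ≤ f θ)
    {C : ℝ} (hfC : ∀ θ, f θ ≤ C) :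
    ∀ᵐ ω ∂μ, ∃ c, Tendsto (fun n => M.evidenceRatio base p θr (data x y n ω) *
      ∫ θ, f θ ∂M.post base p (data x y n ω)) atTop (𝓝 c) := by
  filter_upwards [h.ae_tendsto hp hθr (Q := fun L => ∫ θ, f θ ∂M.post base p L)
    (fun L => integral_nonneg hf0) fun L a => (M.deltaQ_integral_post hp L a
      (M.integrable_post_of_bound hp L hf C fun θ => by
        rw [abs_of_nonneg (hf0 θ)]; exact hfC θ)).ge] with ω hω using hω.1

end Run

/-! ### Concentration of the posterior -/

section Concentration

variable {Θ X Y Ω : Type*} [MeasurableSpace Θ] [MeasurableSingletonClass Θ] [Fintype X] [Fintype Y]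
  {m : MeasurableSpace Ω} {M : Model Θ X Y} {base : Measure Θ} {p : Θ → ℝ} {θr : Θ}
  {acq : List (X × Y) → X → ℝ} {μ : Measure Ω} [IsProbabilityMeasure μ] {ℱ : Filtration ℕ m}
  {x : ℕ → Ω → X} {y : ℕ → Ω → Y}

/-- The evidence ratio converges almost surely, so that the posterior mass of `θr` keeps away
from `0`. -/
lemma IsRun.ae_exists_tendsto_evidenceRatio (h : IsRun M θr acq μ ℱ x y)
    (hp : IsPriorDensity base p) (hθr : 0 < ∫ θ in {θr}, p θ ∂base) :
    ∀ᵐ ω ∂μ, ∃ c, 0 < c ∧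
      Tendsto (fun n => M.evidenceRatio base p θr (data x y n ω)) atTop (𝓝 c) := by
  filter_upwards [h.ae_exists_tendsto_weighted_integral hp hθr (f := fun _ => 1) measurable_const
    (fun _ => zero_le_one) (fun _ => le_rfl), h.ae_likelihood_ne_zero] with ω ⟨c, hc⟩ hlik
  have hc' : Tendsto (fun n => M.evidenceRatio base p θr (data x y n ω)) atTop (𝓝 c) := by
    refine hc.congr fun n => ?_
    have := M.isProbabilityMeasure_post hp (M.evidence_ne_zero hp hθr (hlik n))
    simp
  exact ⟨c, hθr.trans_le (ge_of_tendsto' hc' fun n =>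
    M.prior_le_evidenceRatio hp θr (hlik n)), hc'⟩

/-- Posterior expectations of bounded functions converge almost surely. -/
lemma IsRun.ae_exists_tendsto_integral (h : IsRun M θr acq μ ℱ x y)
    (hp : IsPriorDensity base p) (hθr : 0 < ∫ θ in {θr}, p θ ∂base) {f : Θ → ℝ}
    (hf : Measurable f) (hf0 : ∀ θ, 0 ≤ f θ) {C : ℝ} (hfC : ∀ θ, f θ ≤ C) :
    ∀ᵐ ω ∂μ, ∃ c, Tendsto (fun n => ∫ θ, f θ ∂M.post base p (data x y n ω)) atTop (𝓝 c) := by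
  filter_upwards [h.ae_exists_tendsto_weighted_integral hp hθr hf hf0 hfC,
    h.ae_exists_tendsto_evidenceRatio hp hθr, h.ae_likelihood_ne_zero]
    with ω ⟨c, hc⟩ ⟨r, hr, hr'⟩ hlik
  refine ⟨c / r, (hc.div hr' hr.ne').congr fun n => ?_⟩
  rw [Pi.div_apply, mul_div_cancel_left₀]
  exact (hθr.trans_le (M.prior_le_evidenceRatio hp θr (hlik n))).ne'

/-- If the posterior mean of a function vanishing only at `θr` tends to `0`, then the posterior
concentrates at `θr`. The posterior mass of the parameters other than `θr` at which the function
is small is controlled, in the mean and uniformly along the run, by their prior mass. -/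
lemma IsRun.ae_tendsto_post_compl (h : IsRun M θr acq μ ℱ x y) (hp : IsPriorDensity base p)
    (hθr : 0 < ∫ θ in {θr}, p θ ∂base) {d : Θ → ℝ} (hd : Measurable d) (hd0 : ∀ θ, 0 ≤ d θ)
    {C : ℝ} (hdC : ∀ θ, d θ ≤ C) (hsep : ∀ θ, d θ = 0 → θ = θr)
    (hlim : ∀ᵐ ω ∂μ,
      Tendsto (fun n => ∫ θ, d θ ∂M.post base p (data x y n ω)) atTop (𝓝 0)) :
    ∀ᵐ ω ∂μ, Tendsto (fun n => (M.post base p (data x y n ω)).real {θr}ᶜ) atTop (𝓝 0) := by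
  -- The parameters other than `θr` at which `d` is small; their prior mass tends to `0`.
  let B : ℕ → Set Θ := fun k => {θ | d θ < 1 / ((k : ℝ) + 1)} \ {θr}
  have hB : ∀ k, MeasurableSet (B k) := fun k =>
    (measurableSet_lt hd measurable_const).diff (measurableSet_singleton θr)
  let T : Set Θ → ℕ → Ω → ℝ := fun A n ω =>
    M.evidenceRatio base p θr (data x y n ω) * (M.post base p (data x y n ω)).real A
  have hT0 : ∀ A n ω, 0 ≤ T A n ω := fun A n ω =>
    mul_nonneg (M.evidenceRatio_nonneg hp θr _) measureReal_nonneg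
  have hind : ∀ {A : Set Θ}, MeasurableSet A → ∀ L : List (X × Y),
      ∫ θ, A.indicator (fun _ => (1 : ℝ)) θ ∂M.post base p L = (M.post base p L).real A :=
    fun hA L => by rw [integral_indicator_const _ hA, smul_eq_mul, mul_one]
  have hconv : ∀ {A : Set Θ}, MeasurableSet A →
      ∀ᵐ ω ∂μ, ∃ c, Tendsto (fun n => T A n ω) atTop (𝓝 c) := fun {A} hA => by
    have := h.ae_exists_tendsto_weighted_integral hp hθr
      (f := A.indicator fun _ => (1 : ℝ)) (measurable_const.indicator hA)
      (fun θ => Set.indicator_nonneg (fun _ _ => zero_le_one) θ) (C := 1)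
      (fun θ => Set.indicator_le_self' (fun _ _ => zero_le_one) θ)
    simpa only [hind hA] using this
  have hcompl : MeasurableSet ({θr}ᶜ : Set Θ) := (measurableSet_singleton θr).compl
  have hTm : ∀ A n, Measurable fun ω => ENNReal.ofReal (T A n ω) := fun A n =>
    ((h.measurable_comp n fun l _ => M.evidenceRatio base p θr l *
      (M.post base p l).real A).mono (ℱ.le n) le_rfl).ennreal_ofReal
  let F : Set Θ → Ω → ENNReal := fun A ω => liminf (fun n => ENNReal.ofReal (T A n ω)) atTop
  have hFm : Measurable (F {θr}ᶜ) := Measurable.liminf (hTm _)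
  have hFB : ∀ k, ∫⁻ ω, F (B k) ω ∂μ ≤ M.post base p [] (B k) := fun k => by
    have := M.isFiniteMeasure_post hp ([] : List (X × Y))
    refine (lintegral_liminf_le (hTm (B k))).trans ?_
    refine (liminf_le_liminf (Eventually.of_forall fun n => ?_)).trans
      (liminf_const (M.post base p [] (B k))).le
    have hb := h.lintegral_weighted_le hp
      (Q := fun L => ∫ θ, (B k).indicator (fun _ => (1 : ℝ)) θ ∂M.post base p L)
      (fun L => integral_nonneg fun θ => Set.indicator_nonneg (fun _ _ => zero_le_one) θ)
      (fun L a => (M.deltaQ_integral_post hp L a (by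
        have := M.isFiniteMeasure_post hp L
        exact (integrable_const (1 : ℝ)).indicator (hB k))).ge) n
    simp only [hind (hB k)] at hb
    rwa [ofReal_measureReal] at hb
  have hle : ∀ k, ∀ᵐ ω ∂μ, F {θr}ᶜ ω ≤ F (B k) ω := fun k => by
    filter_upwards [hconv hcompl, hconv (hB k), hlim, h.ae_exists_tendsto_evidenceRatio hp hθr]
      with ω ⟨c, hc⟩ ⟨v, hv⟩ hdω ⟨r, _, hr⟩
    have hF1 : F {θr}ᶜ ω = ENNReal.ofReal c := (ENNReal.tendsto_ofReal hc).liminf_eq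
    have hF2 : F (B k) ω = ENNReal.ofReal v := (ENNReal.tendsto_ofReal hv).liminf_eq
    rw [hF1, hF2]
    refine ENNReal.ofReal_le_ofReal ?_
    have hlim' := ((hr.mul hdω).const_mul ((k : ℝ) + 1)).add hv
    rw [mul_zero, mul_zero, zero_add] at hlim'
    refine le_of_tendsto_of_tendsto' hc hlim' fun n => ?_
    have := M.isFiniteMeasure_post hp (data x y n ω)
    have hdi : Integrable d (M.post base p (data x y n ω)) :=
      M.integrable_post_of_bound hp _ hd C fun θ => by
        rw [abs_of_nonneg (hd0 θ)]; exact hdC θ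
    have hmass : (M.post base p (data x y n ω)).real {θr}ᶜ ≤
        ((k : ℝ) + 1) * ∫ θ, d θ ∂M.post base p (data x y n ω) +
          (M.post base p (data x y n ω)).real (B k) := by
      rw [← hind hcompl, ← hind (hB k), ← integral_const_mul, ← integral_add (hdi.const_mul _)
        ((integrable_const (1 : ℝ)).indicator (hB k))]
      refine integral_mono ((integrable_const (1 : ℝ)).indicator hcompl)
        ((hdi.const_mul _).add ((integrable_const (1 : ℝ)).indicator (hB k))) fun θ => ?_
      have hk : (0 : ℝ) < k + 1 := by positivity
      have hdk : 0 ≤ ((k : ℝ) + 1) * d θ := mul_nonneg hk.le (hd0 θ)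
      have hi0 : 0 ≤ (B k).indicator (fun _ => (1 : ℝ)) θ :=
        Set.indicator_nonneg (fun _ _ => zero_le_one) θ
      beta_reduce
      by_cases h1 : θ = θr
      · have h2 : θ ∉ ({θr}ᶜ : Set Θ) := fun h3 => h3 h1
        rw [Set.indicator_of_notMem h2]
        exact add_nonneg hdk hi0
      · rw [Set.indicator_of_mem (show θ ∈ ({θr}ᶜ : Set Θ) from h1)]
        by_cases h3 : d θ < 1 / ((k : ℝ) + 1)
        · rw [Set.indicator_of_mem (show θ ∈ B k from ⟨h3, h1⟩)]
          linarith
        · have h4 : 1 ≤ ((k : ℝ) + 1) * d θ := by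
            rw [not_lt, div_le_iff₀ hk] at h3
            linarith
          linarith
    calc T {θr}ᶜ n ω
        ≤ M.evidenceRatio base p θr (data x y n ω) *
            (((k : ℝ) + 1) * ∫ θ, d θ ∂M.post base p (data x y n ω) +
              (M.post base p (data x y n ω)).real (B k)) :=
          mul_le_mul_of_nonneg_left hmass (M.evidenceRatio_nonneg hp θr _)
      _ = _ := by simp only [T]; ring
  have hanti : Tendsto (fun k => M.post base p [] (B k)) atTop (𝓝 0) := by
    have := M.isFiniteMeasure_post hp ([] : List (X × Y))
    have hempty : ⋂ k, B k = ∅ := by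
      refine Set.eq_empty_iff_forall_notMem.2 fun θ hθ => ?_
      rw [Set.mem_iInter] at hθ
      refine (hθ 0).2 (hsep θ (le_antisymm ?_ (hd0 θ)))
      exact ge_of_tendsto' tendsto_one_div_add_atTop_nhds_zero_nat fun k => (hθ k).1.le
    have := tendsto_measure_iInter_atTop (μ := M.post base p []) (s := B)
      (fun k => (hB k).nullMeasurableSet) (fun i j hij θ hθ => ⟨lt_of_lt_of_le hθ.1
        (one_div_le_one_div_of_le (by positivity : (0 : ℝ) < (i : ℝ) + 1)
          (by exact_mod_cast Nat.succ_le_succ hij)), hθ.2⟩)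
      ⟨0, measure_ne_top _ _⟩
    rwa [hempty, measure_empty] at this
  have hzero : ∫⁻ ω, F {θr}ᶜ ω ∂μ = 0 :=
    le_antisymm (ge_of_tendsto' hanti fun k =>
      (lintegral_mono_ae (hle k)).trans (hFB k)) bot_le
  filter_upwards [(lintegral_eq_zero_iff hFm).1 hzero, hconv hcompl,
    h.ae_exists_tendsto_evidenceRatio hp hθr, h.ae_likelihood_ne_zero]
    with ω hF ⟨c, hc⟩ ⟨r, hr, hr'⟩ hlik
  have hF1 : F {θr}ᶜ ω = ENNReal.ofReal c := (ENNReal.tendsto_ofReal hc).liminf_eq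
  have hc0 : c = 0 := le_antisymm (ENNReal.ofReal_eq_zero.1 (hF1.symm.trans hF))
    (ge_of_tendsto' hc fun n => hT0 _ n ω)
  have hq := hc.div hr' hr.ne'
  rw [hc0, zero_div] at hq
  refine hq.congr fun n => ?_
  simp only [T]
  rw [Pi.div_apply, mul_div_cancel_left₀]
  exact (hθr.trans_le (M.prior_le_evidenceRatio hp θr (hlik n))).ne'

omit [Fintype X] in
lemma tendstoPointMass_of_post_compl (hp : IsPriorDensity base p)
    (hθr : 0 < ∫ θ in {θr}, p θ ∂base) {L : ℕ → List (X × Y)}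
    (hL : ∀ n, M.likelihood (L n) θr ≠ 0)
    (h : Tendsto (fun n => (M.post base p (L n)).real {θr}ᶜ) atTop (𝓝 0)) :
    TendstoPointMass base (fun n => M.posterior base p (L n)) θr := by
  intro A hA
  have hprob : ∀ n, IsProbabilityMeasure (M.post base p (L n)) := fun n =>
    M.isProbabilityMeasure_post hp (M.evidence_ne_zero hp hθr (hL n))
  have key : ∀ B : Set Θ, θr ∉ B →
      Tendsto (fun n => (M.post base p (L n)).real B) atTop (𝓝 0) := fun B hB => by
    have hsub : B ⊆ {θr}ᶜ := Set.subset_compl_singleton_iff.2 hB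
    exact squeeze_zero (fun n => measureReal_nonneg)
      (fun n => measureReal_mono hsub (measure_ne_top _ _)) h
  simp_rw [← M.post_real_apply hp _ hA]
  by_cases hmem : θr ∈ A
  · rw [Set.indicator_of_mem hmem]
    have := (key Aᶜ fun h' => h' hmem).const_sub 1
    rw [sub_zero] at this
    refine this.congr fun n => ?_
    rw [probReal_compl_eq_one_sub hA, sub_sub_cancel]
  · rw [Set.indicator_of_notMem hmem]
    exact key A hmem

/-- If the posterior variances of the label probabilities at an identifying set of inputs tend to
`0`, then the posterior converges to the point mass at the true parameter. -/
theorem IsRun.ae_tendstoPointMass (h : IsRun M θr acq μ ℱ x y) (hp : IsPriorDensity base p)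
    (hθr : 0 < ∫ θ in {θr}, p θ ∂base) {s : Set X} (hs : M.IdentifiableOn s)
    (hvar : ∀ᵐ ω ∂μ, ∀ a ∈ s, ∀ b,
      Tendsto (fun n => M.postVar base p a b (data x y n ω)) atTop (𝓝 0)) :
    ∀ᵐ ω ∂μ, TendstoPointMass base (fun n => M.posterior base p (data x y n ω)) θr := by
  classical
  let e : X → Y → Θ → ℝ := fun a b θ => (M.prob θ a b - M.prob θr a b) ^ 2
  let d : Θ → ℝ := fun θ => ∑ a with a ∈ s, ∑ b, e a b θ
  have hem : ∀ a b, Measurable (e a b) := fun a b =>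
    ((M.measurable_prob a b).sub_const _).pow_const 2
  have he0 : ∀ a b θ, 0 ≤ e a b θ := fun a b θ => sq_nonneg _
  have he1 : ∀ a b θ, e a b θ ≤ 1 := fun a b θ => by
    rw [sq_le_one_iff_abs_le_one, abs_le]
    constructor <;> linarith [M.prob_nonneg θ a b, M.prob_le_one θ a b, M.prob_nonneg θr a b,
      M.prob_le_one θr a b]
  have hd : Measurable d :=
    Finset.measurable_fun_sum _ fun a _ => Finset.measurable_fun_sum _ fun b _ => hem a b
  have hd0 : ∀ θ, 0 ≤ d θ := fun θ =>
    Finset.sum_nonneg fun a _ => Finset.sum_nonneg fun b _ => he0 a b θ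
  have hsep : ∀ θ, d θ = 0 → θ = θr := fun θ hθ => by
    refine hs θ θr fun a ha b => ?_
    have h1 := (Finset.sum_eq_zero_iff_of_nonneg fun a _ =>
      Finset.sum_nonneg fun b _ => he0 a b θ).1 hθ a (by simpa using ha)
    have h2 := (Finset.sum_eq_zero_iff_of_nonneg fun b _ => he0 a b θ).1 h1 b (Finset.mem_univ b)
    exact sub_eq_zero.1 (pow_eq_zero_iff two_ne_zero |>.1 h2)
  have hlim : ∀ᵐ ω ∂μ,
      Tendsto (fun n => ∫ θ, d θ ∂M.post base p (data x y n ω)) atTop (𝓝 0) := by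
    filter_upwards [hvar, h.ae_exists_tendsto_evidenceRatio hp hθr, h.ae_likelihood_ne_zero]
      with ω hv ⟨r, _, hr⟩ hlik
    have hei : ∀ n a b, Integrable (e a b) (M.post base p (data x y n ω)) := fun n a b =>
      M.integrable_post_of_bound hp _ (hem a b) 1 fun θ => by
        rw [abs_of_nonneg (he0 a b θ)]; exact he1 a b θ
    have hz : Tendsto (fun n => ∑ a with a ∈ s, ∑ b, ∫ θ, e a b θ ∂M.post base p (data x y n ω))
        atTop (𝓝 (∑ a with a ∈ s, ∑ _b : Y, 0)) := by
      refine tendsto_finsetSum _ fun a ha => tendsto_finsetSum _ fun b _ => ?_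
      have hb := (hv a (by simpa using ha) b).mul
        ((hr.div_const (∫ θ in {θr}, p θ ∂base)).const_add 1)
      rw [zero_mul] at hb
      exact squeeze_zero (fun n => integral_nonneg (he0 a b))
        (fun n => M.integral_sub_sq_le hp hθr (hlik n) a b) hb
    simp only [Finset.sum_const_zero] at hz
    refine hz.congr fun n => ?_
    simp only [d]
    rw [integral_finsetSum _ fun a _ => integrable_finsetSum _ fun b _ => hei n a b]
    exact Finset.sum_congr rfl fun a _ => (integral_finsetSum _ fun b _ => hei n a b).symm
  filter_upwards [h.ae_tendsto_post_compl hp hθr hd hd0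
    (C := ∑ a with a ∈ s, ∑ _b : Y, 1)
    (fun θ => Finset.sum_le_sum fun a _ => Finset.sum_le_sum fun b _ => he1 a b θ) hsep hlim,
    h.ae_likelihood_ne_zero] with ω hω hlik
  exact tendstoPointMass_of_post_compl hp hθr hlik hω

/-! ### BALD -/

/-- BALD: each query learns, in the limit, nothing about the label at the queried input. As that
input maximizes the mutual information, the mutual information vanishes at all inputs. -/
theorem bald_convergence (hp : IsPriorDensity base p) (hθr : 0 < ∫ θ in {θr}, p θ ∂base)
    (hid : M.IdentifiableOn Set.univ) (hent : Integrable (fun θ => Real.negMulLog (p θ)) base)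
    (h : IsRun M θr (M.deltaQ base p (M.costI base p)) μ ℱ x y) :
    ∀ᵐ ω ∂μ,
      (∀ a, Tendsto (fun n => M.deltaQ base p (M.costI base p) (data x y n ω) a) atTop (𝓝 0)) ∧
      TendstoPointMass base (fun n => M.posterior base p (data x y n ω)) θr := by
  -- The posterior variances, as costs, control the queried inputs.
  have hgap : ∀ᵐ ω ∂μ, ∀ a,
      Tendsto (fun n => M.jensenGap base p negEntropy (data x y n ω) a) atTop (𝓝 0) := by
    have hvar : ∀ᵐ ω ∂μ, ∀ a b, Tendsto (fun n =>
        M.deltaQ base p (M.postVar base p a b) (data x y n ω) (x n ω)) atTop (𝓝 0) := by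
      refine ae_all_iff.2 fun a => ae_all_iff.2 fun b => ?_
      filter_upwards [h.ae_tendsto hp hθr (M.postVar_nonneg hp a b)
        (M.deltaQ_postVar_nonneg hp a b)] with ω hω using hω.2
    filter_upwards [hvar, h.ae_likelihood_ne_zero, h.maximizes] with ω hv hlik hmax a
    have hZ : ∀ n, M.evidence base p (data x y n ω) ≠ 0 := fun n =>
      M.evidence_ne_zero hp hθr (hlik n)
    have hself : ∀ b, Tendsto (fun n => M.postVar base p (x n ω) b (data x y n ω))
        atTop (𝓝 0) := fun b => by
      -- The queried input varies with `n`, so the bound sums over all inputs.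
      have hsum : Tendsto (fun n => ∑ a,
          M.deltaQ base p (M.postVar base p a b) (data x y n ω) (x n ω)) atTop (𝓝 0) := by
        simpa using tendsto_finsetSum Finset.univ fun a _ => hv a b
      have hsq : Tendsto (fun n => M.postVar base p (x n ω) b (data x y n ω) ^ 2)
          atTop (𝓝 0) :=
        squeeze_zero (fun n => sq_nonneg _) (fun n =>
          (M.sq_postVar_le_deltaQ hp (x n ω) b (data x y n ω)).trans
            (Finset.single_le_sum
              (f := fun a => M.deltaQ base p (M.postVar base p a b) (data x y n ω) (x n ω))
              (fun a _ => M.deltaQ_postVar_nonneg hp a b _ _) (Finset.mem_univ (x n ω)))) hsum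
      have := hsq.sqrt
      rw [Real.sqrt_zero] at this
      exact this.congr fun n => Real.sqrt_sq (M.postVar_nonneg hp _ _ _)
    refine squeeze_zero (fun n => M.jensenGap_negEntropy_nonneg hp (hZ n) a) (fun n => ?_)
      (M.tendsto_jensenGap hp continuous_negEntropy.continuousOn hZ
        (fun n => M.jensenGap_negEntropy_nonneg hp (hZ n) (x n ω)) hself)
    have := hmax n a
    rwa [M.deltaQ_costI hp hent, M.deltaQ_costI hp hent] at this
  have hvar : ∀ᵐ ω ∂μ, ∀ a ∈ Set.univ, ∀ b,
      Tendsto (fun n => M.postVar base p a b (data x y n ω)) atTop (𝓝 0) := by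
    filter_upwards [hgap, h.ae_likelihood_ne_zero] with ω hω hlik a _ b
    have h4 := (hω a).const_mul 4
    rw [mul_zero] at h4
    refine squeeze_zero (fun n => M.postVar_nonneg hp a b _) (fun n => ?_) h4
    have h1 := M.sum_postVar_le_jensenGap hp (M.evidence_ne_zero hp hθr (hlik n)) a
    have h2 := Finset.single_le_sum (f := fun b => M.postVar base p a b (data x y n ω) / 4)
      (fun b _ => div_nonneg (M.postVar_nonneg hp a b _) (by norm_num)) (Finset.mem_univ b)
    linarith
  filter_upwards [hgap, h.ae_tendstoPointMass hp hθr hid hvar] with ω h1 h2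
  refine ⟨fun a => ?_, h2⟩
  simp_rw [M.deltaQ_costI hp hent]
  exact h1 a

/-! ### BEMPS -/

omit [MeasurableSingletonClass Θ] [Fintype X] in
/-- If the labels at `a` carry, in the limit, no information on the labels at `a` itself, as
measured by a strictly proper scoring rule, then the posterior variances of the label
probabilities at `a` vanish: by strict convexity a further label at `a` does not move the limit of
the predictive. -/
lemma tendsto_postVar_of_predictiveGain (hp : IsPriorDensity base p)
    {S : (Y → ℝ) → Y → EReal} (hS : IsStrictlyProper S)
    (hG : ContinuousOn (savageG S) (stdSimplex ℝ Y)) {L : ℕ → List (X × Y)}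
    (hL : ∀ n, M.evidence base p (L n) ≠ 0) {a : X} {c : Y → ℝ} {q : Y → Y → ℝ}
    (hc : ∀ b, Tendsto (fun n => M.predictive base p (L n) a b) atTop (𝓝 (c b)))
    (hq : ∀ b b', Tendsto (fun n => ∫ θ, M.prob θ a b * M.prob θ a b' ∂M.post base p (L n))
      atTop (𝓝 (q b b')))
    (hgain : Tendsto (fun n => M.predictiveGain base p (savageG S) (L n) a a) atTop (𝓝 0))
    (b : Y) : Tendsto (fun n => M.postVar base p a b (L n)) atTop (𝓝 0) := by
  have hmem : ∀ n, M.predictive base p (L n) a ∈ stdSimplex ℝ Y := fun n =>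
    M.predictive_mem_stdSimplex hp (hL n) a
  have hcvec : Tendsto (fun n => M.predictive base p (L n) a) atTop (𝓝 c) := tendsto_pi_nhds.2 hc
  have hcmem : c ∈ stdSimplex ℝ Y :=
    (isClosed_stdSimplex ℝ Y).mem_of_tendsto hcvec (Eventually.of_forall hmem)
  have hGc : Tendsto (fun n => savageG S (M.predictive base p (L n) a)) atTop
      (𝓝 (savageG S c)) :=
    (hG c hcmem).tendsto.comp (tendsto_nhdsWithin_iff.2 ⟨hcvec, Eventually.of_forall hmem⟩)
  -- The limit of the predictive at `a` after the further label `b` at `a`; junk if `c b = 0`.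
  let r : Y → Y → ℝ := fun b b' => q b b' / c b
  have hcons : ∀ n b b', M.predictive base p (L n) a b *
      M.predictive base p ((a, b) :: L n) a b' =
      ∫ θ, M.prob θ a b * M.prob θ a b' ∂M.post base p (L n) := fun n b b' => by
    rw [M.predictive_eq hp ((a, b) :: L n)]
    exact M.predictive_mul_integral_post_cons hp (L n) a b fun θ => M.prob θ a b'
  have hmemc : ∀ {n b}, M.predictive base p (L n) a b ≠ 0 →
      M.predictive base p ((a, b) :: L n) a ∈ stdSimplex ℝ Y := fun {n b} hb => by
    refine M.predictive_mem_stdSimplex hp ?_ a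
    rw [M.evidence_cons hp]
    exact mul_ne_zero (hL n) hb
  have hr : ∀ b, c b ≠ 0 →
      Tendsto (fun n => M.predictive base p ((a, b) :: L n) a) atTop (𝓝 (r b)) := fun b hb => by
    refine tendsto_pi_nhds.2 fun b' => ((hq b b').div (hc b) hb).congr' ?_
    filter_upwards [(hc b).eventually_ne hb] with n hn
    rw [Pi.div_apply, ← hcons, mul_div_cancel_left₀ _ hn]
  have hrmem : ∀ b, c b ≠ 0 → r b ∈ stdSimplex ℝ Y := fun b hb => by
    refine (isClosed_stdSimplex ℝ Y).mem_of_tendsto (hr b hb) ?_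
    filter_upwards [(hc b).eventually_ne hb] with n hn using hmemc hn
  have hterm : ∀ b, Tendsto (fun n => M.predictive base p (L n) a b *
      savageG S (M.predictive base p ((a, b) :: L n) a)) atTop (𝓝 (c b * savageG S (r b))) := by
    intro b
    by_cases hb : c b = 0
    · obtain ⟨C, hC⟩ := (isCompact_stdSimplex ℝ Y).exists_bound_of_continuousOn hG
      have hz := (hc b).mul_const C
      rw [hb, zero_mul] at hz
      rw [hb, zero_mul]
      refine squeeze_zero_norm (fun n => ?_) hz
      rw [norm_mul, Real.norm_of_nonneg ((hmem n).1 b)]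
      by_cases hn : M.predictive base p (L n) a b = 0
      · simp [hn]
      · exact mul_le_mul_of_nonneg_left (hC _ (hmemc hn)) ((hmem n).1 b)
    · refine (hc b).mul ((hG (r b) (hrmem b hb)).tendsto.comp (tendsto_nhdsWithin_iff.2
        ⟨hr b hb, ?_⟩))
      filter_upwards [(hc b).eventually_ne hb] with n hn using hmemc hn
  have heq : ∑ b, c b * savageG S (r b) - savageG S c = 0 :=
    tendsto_nhds_unique ((tendsto_finsetSum _ fun b _ => hterm b).sub hGc) hgain
  have hqc : ∀ b b', c b = 0 → q b b' = 0 := fun b b' hb => by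
    refine tendsto_nhds_unique (hq b b') (squeeze_zero (fun n => ?_) (fun n => ?_) (hb ▸ hc b))
    · exact integral_nonneg fun θ => mul_nonneg (M.prob_nonneg θ a b) (M.prob_nonneg θ a b')
    · rw [M.predictive_eq hp]
      refine integral_mono_of_nonneg (ae_of_all _ fun θ =>
        mul_nonneg (M.prob_nonneg θ a b) (M.prob_nonneg θ a b')) (M.integrable_prob hp _ a b)
        (ae_of_all _ fun θ => ?_)
      exact mul_le_of_le_one_right (M.prob_nonneg θ a b) (M.prob_le_one θ a b')
  have hcr : ∀ b b', c b * r b b' = q b b' := fun b b' => by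
    by_cases hb : c b = 0
    · rw [hqc b b' hb, hb, zero_mul]
    · exact mul_div_cancel₀ _ hb
  have hmix : ∀ b', ∑ b, c b * r b b' = c b' := fun b' => by
    simp_rw [hcr]
    refine tendsto_nhds_unique (tendsto_finsetSum _ fun b _ => hq b b') ((hc b').congr fun n => ?_)
    simp_rw [← hcons]
    exact (M.sum_predictive_mul_predictive_cons hp (L n) a a b').symm
  have hfinal : q b b = c b ^ 2 := by
    by_cases hb : c b = 0
    · rw [hqc b b hb, hb, zero_pow two_ne_zero]
    · have := hS.eq_of_sum_le hcmem.1 hcmem hrmem hmix (sub_eq_zero.1 heq).le hb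
      rw [← hcr, this, sq]
  have := (hq b b).sub ((hc b).pow 2)
  rw [hfinal, sub_self] at this
  refine this.congr fun n => ?_
  simp only [Model.postVar, sq]

/-- BEMPS: the cost itself drives the convergence, as it is nonnegative and does not increase in the
mean under the predictive. -/
theorem bemps_convergence (hp : IsPriorDensity base p) (hθr : 0 < ∫ θ in {θr}, p θ ∂base)
    {px : X → ℝ} {S : (Y → ℝ) → Y → EReal} (hpx : ∀ a, 0 ≤ px a) (hS : IsStrictlyProper S)
    (hG : ContinuousOn (savageG S) (stdSimplex ℝ Y)) (hid : M.IdentifiableOn {a | 0 < px a})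
    (h : IsRun M θr (M.deltaQ base p (M.costS base p px S)) μ ℱ x y) :
    ∀ᵐ ω ∂μ,
      (∀ a, Tendsto (fun n => M.deltaQ base p (M.costS base p px S) (data x y n ω) a)
        atTop (𝓝 0)) ∧
      Tendsto (fun n => M.costS base p px S (data x y n ω)) atTop (𝓝 0) ∧
      TendstoPointMass base (fun n => M.posterior base p (data x y n ω)) θr := by
  have hΔnn := M.deltaQ_costS_nonneg hp hpx hS hG
  have hΔ : ∀ᵐ ω ∂μ, ∀ a, Tendsto (fun n =>
      M.deltaQ base p (M.costS base p px S) (data x y n ω) a) atTop (𝓝 0) := by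
    filter_upwards [h.ae_tendsto hp hθr (M.costS_nonneg hp hpx hS hG) hΔnn, h.maximizes]
      with ω hω hmax a
    exact squeeze_zero (fun n => hΔnn _ a) (fun n => hmax n a) hω.2
  have hconv1 : ∀ᵐ ω ∂μ, ∀ a b, ∃ c, Tendsto (fun n =>
      M.predictive base p (data x y n ω) a b) atTop (𝓝 c) := by
    refine ae_all_iff.2 fun a => ae_all_iff.2 fun b => ?_
    simp_rw [M.predictive_eq hp]
    exact h.ae_exists_tendsto_integral hp hθr (M.measurable_prob a b)
      (fun θ => M.prob_nonneg θ a b) (fun θ => M.prob_le_one θ a b)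
  have hconv2 : ∀ᵐ ω ∂μ, ∀ a b b', ∃ c, Tendsto (fun n =>
      ∫ θ, M.prob θ a b * M.prob θ a b' ∂M.post base p (data x y n ω)) atTop (𝓝 c) := by
    refine ae_all_iff.2 fun a => ae_all_iff.2 fun b => ae_all_iff.2 fun b' => ?_
    exact h.ae_exists_tendsto_integral hp hθr
      ((M.measurable_prob a b).mul (M.measurable_prob a b'))
      (fun θ => mul_nonneg (M.prob_nonneg θ a b) (M.prob_nonneg θ a b'))
      (fun θ => mul_le_one₀ (M.prob_le_one θ a b) (M.prob_nonneg θ a b') (M.prob_le_one θ a b'))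
  have hvar : ∀ᵐ ω ∂μ, ∀ a ∈ {a | 0 < px a}, ∀ b,
      Tendsto (fun n => M.postVar base p a b (data x y n ω)) atTop (𝓝 0) := by
    filter_upwards [hΔ, hconv1, hconv2, h.ae_likelihood_ne_zero] with ω hω h1 h2 hlik a ha b
    choose c hc using h1 a
    choose q hq using h2 a
    refine tendsto_postVar_of_predictiveGain hp hS hG
      (fun n => M.evidence_ne_zero hp hθr (hlik n)) hc hq ?_ b
    -- Among the gains that make up the acquisition function is that of the labels at `a` for `a`.
    have hdiv := (hω a).div_const (px a)
    rw [zero_div] at hdiv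
    refine squeeze_zero (fun n => M.predictiveGain_nonneg hp hS _ a a) (fun n => ?_) hdiv
    rw [le_div_iff₀ ha, mul_comm, M.deltaQ_costS hp px hG]
    exact Finset.single_le_sum
      (f := fun a' => px a' * M.predictiveGain base p (savageG S) (data x y n ω) a a')
      (fun a' _ => mul_nonneg (hpx a') (M.predictiveGain_nonneg hp hS _ a a')) (Finset.mem_univ a)
  filter_upwards [hΔ, hvar, h.ae_tendstoPointMass hp hθr hid hvar, h.ae_likelihood_ne_zero]
    with ω h1 h2 h3 hlik
  refine ⟨h1, ?_, h3⟩
  simp_rw [M.costS_eq hp px hG]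
  have hsum : Tendsto (fun n => ∑ a, px a * M.jensenGap base p (savageG S) (data x y n ω) a)
      atTop (𝓝 (∑ _a : X, 0)) := by
    refine tendsto_finsetSum _ fun a _ => ?_
    rcases (hpx a).eq_or_lt with ha | ha
    · simp [← ha]
    · have := (M.tendsto_jensenGap hp hG (x := fun _ => a)
        (fun n => M.evidence_ne_zero hp hθr (hlik n))
        (fun n => M.jensenGap_savageG_nonneg hp hS hG _ a) (h2 a ha)).const_mul (px a)
      rwa [mul_zero] at this
  simpa using hsum

end Concentration

end ActiveLearning

end

theorem mainTheorem1 {Θ X Y Ω : Type*} [MeasurableSpace Θ] [MeasurableSingletonClass Θ]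
    [Fintype X] [Fintype Y] {m : MeasurableSpace Ω}
    (M : ActiveLearning.Model Θ X Y) (base : Measure Θ) (p : Θ → ℝ)
    (hp : ActiveLearning.IsPriorDensity base p)
    (θr : Θ) (hθr : 0 < ∫ θ in {θr}, p θ ∂base)
    (μ : Measure Ω) [IsProbabilityMeasure μ] (ℱ : Filtration ℕ m)
    (x : ℕ → Ω → X) (y : ℕ → Ω → Y) :
    -- BALD
    (M.IdentifiableOn Set.univ →
      Integrable (fun θ => Real.negMulLog (p θ)) base →
      ActiveLearning.IsRun M θr (M.deltaQ base p (M.costI base p)) μ ℱ x y →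
      ∀ᵐ ω ∂μ,
        (∀ a, Tendsto (fun n => M.deltaQ base p (M.costI base p)
          (ActiveLearning.labelled (x · ω) (y · ω) n) a) atTop (𝓝 0)) ∧
        ActiveLearning.TendstoPointMass base
          (fun n => M.posterior base p (ActiveLearning.labelled (x · ω) (y · ω) n)) θr) ∧
    -- BEMPS
    (∀ (px : X → ℝ) (S : (Y → ℝ) → Y → EReal), px ∈ stdSimplex ℝ X →
      ActiveLearning.IsStrictlyProper S →
      ContinuousOn (ActiveLearning.savageG S) (stdSimplex ℝ Y) →
      M.IdentifiableOn {a | 0 < px a} →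
      ActiveLearning.IsRun M θr (M.deltaQ base p (M.costS base p px S)) μ ℱ x y →
      ∀ᵐ ω ∂μ,
        (∀ a, Tendsto (fun n => M.deltaQ base p (M.costS base p px S)
          (ActiveLearning.labelled (x · ω) (y · ω) n) a) atTop (𝓝 0)) ∧
        Tendsto (fun n => M.costS base p px S
          (ActiveLearning.labelled (x · ω) (y · ω) n)) atTop (𝓝 0) ∧
        ActiveLearning.TendstoPointMass base
          (fun n => M.posterior base p (ActiveLearning.labelled (x · ω) (y · ω) n)) θr) :=
  ⟨fun hid hent h => ActiveLearning.bald_convergence hp hθr hid hent h,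
    fun _ _ hpx hS hG hid h => ActiveLearning.bemps_convergence hp hθr hpx.1 hS hG hid h⟩
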